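/- **Setting.** Let $U\subseteq\mathbb R^2$ be a non-empty open set and let $a_{ij}\in C^\infty(U)$ ($1\le i\le k$, $0\le j\le n_i$). Put $L_i(x,y)=\sum_{j=0}^{n_i}a_{ij}(x,y)D^j$ with $D=d/dx$. The expression $\mathcal J=L_1(x,y)\varphi_1(x)+\dots+L_k(x,y)\varphi_k(x)$ is called a *multiintegral*. All differential operators below are linear ordinary differential operators in $x$ with smooth coefficients; $R(x)$ denotes one whose coefficients depend on $x$ only. For an open rectangle $I\times J\subseteq U$ ($I,J$ non-empty open intervals), the *kernel* of $\mathcal J$ on $I\times J$ is the real vector space of all $(\varphi_1,\dots,\varphi_k)\in C^\infty(I)^k$ for which $\mathcal J$ vanishes identically on $I\times J$. **Algorithm RI on $I\times J$.** An output for an operator $N(x,y)$ consists of points $y_1,\dots,y_s\in J$ and operators $P_1(x),\dots,P_s(x)$, $R(x)$, $K(x,y)$ such that $R(x)=\sum_a P_a(x)N(x,y_a)$, the leading coefficient of $R$ vanishes nowhere on $I$, and $N(x,y)=K(x,y)R(x)$. (Thus $R$ is the right greatest common divisor of the operators $N(x,y_a)$, and it right divides $N(x,y)$.) **Algorithm RMI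 on $I\times J$.** The columns $j=1,\dots,k$ of the row $(L_1,\dots,L_k)$ are processed from left to right. When column $j$ is reached, some number $r$ of rows have been created, the $i$-th of them with an operator $K_i(x,y)$ and with points $y_{i,a}$ and operators $P_{i,a}(x)$. One computes successively, for $i=1,\dots,r$, $$T_{ij}(x)=\sum_a P_{i,a}(x)\,N^{(i-1)}(x,y_{i,a}),\qquad N^{(i)}=N^{(i-1)}-K_iT_{ij},\qquad N^{(0)}=L_j.$$ If $N^{(r)}=0$, no row is created and $T_{ij}=0$ for $i>r$. Otherwise RI is applied to $N^{(r)}$; its output provides $K_{r+1}$, the points $y_{r+1,a}$, the operators $P_{r+1,a}$, and the pivot $T_{r+1,j}=R$, while $T_{ij}=0$ for $i>r+1$. Let $p$ be the final number of rows. With arbitrarily chosen operators $S_{li}(x)$, $1\le l<i\le p$, one puts $$M_i=K_i+\sum_{l<i}M_lS_{li},\qquad R_{ij}=T_{ij}-\sum_{l>i}S_{il}T_{lj}.$$ The output is the row $(M_1,\dots,M_p)$ and the $p\times k$ echelon matrix $\widehat R(x)=(R_{ij}(x))$, whose pivots have leading coefficients vanishing nowhere on $I$. **Proposition.** (a) There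 is an open rectangle $I\times J\subseteq U$ on which RMI has an output for $(L_1,\dots,L_k)$. (b) Let $I\times J\subseteq U$ be any open rectangle, and let $\widehat R(x)$ be the $p\times k$ matrix of any output of RMI on $I\times J$ (for any of the choices that the algorithm leaves open). Then $p\le k$, and the kernel of $\mathcal J$ on $I\times J$ is infinite-dimensional if and only if $\widehat R$ is non-square, i.e. has more columns than rows ($p<k$). If $p=k$, the dimension of the kernel equals $\sum_{i=1}^k\operatorname{ord}R_{ii}$, the sum of the orders of the operators on the principal diagonal of $\widehat R$. -/

import Mathlib

open scoped ContDiff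
open TopologicalSpace

section Functions

variable {E : Type*} [NormedAddCommGroup E] [NormedSpace ℝ E]

/-- The functions that are smooth on the open set `U` and zero outside of `U`. -/
def smoothSubmodule (U : Opens E) : Submodule ℝ (E → ℝ) where
  carrier := {f | ContDiffOn ℝ ∞ f (U : Set E) ∧ ∀ x, x ∉ U → f x = 0}
  add_mem' := by
    rintro f g ⟨hf, hf'⟩ ⟨hg, hg'⟩
    exact ⟨hf.add hg, fun x hx => by simp [hf' x hx, hg' x hx]⟩
  zero_mem' := ⟨contDiffOn_const, fun _ _ => rfl⟩
  smul_mem' := by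
    rintro c f ⟨hf, hf'⟩
    exact ⟨contDiffOn_const.mul hf, fun x hx => by simp [hf' x hx]⟩

/-- The real vector space `C^∞(U)` of smooth real functions on an open set `U`.  A function on `U`
is represented by its extension by zero to the whole space, so that two elements are equal exactly
when they agree on `U`. -/
def SmoothFun (U : Opens E) : Type _ := smoothSubmodule U

noncomputable instance (U : Opens E) : AddCommGroup (SmoothFun U) :=
  inferInstanceAs (AddCommGroup (smoothSubmodule U))

noncomputable instance (U : Opens E) : Module ℝ (SmoothFun U) :=
  inferInstanceAs (Module ℝ (smoothSubmodule U))

@[ext] theorem SmoothFun.ext {U : Opens E} {f g : SmoothFun U} (h : ∀ x, f.1 x = g.1 x) : f = g :=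
  Subtype.ext (funext h)

@[simp] theorem SmoothFun.val_add {U : Opens E} (f g : SmoothFun U) (x : E) :
    (f + g).1 x = f.1 x + g.1 x := rfl

@[simp] theorem SmoothFun.val_smul {U : Opens E} (c : ℝ) (f : SmoothFun U) (x : E) :
    (c • f).1 x = c * f.1 x := rfl

/-- Restriction of a smooth function to a smaller open set. -/
noncomputable def SmoothFun.restrict {U V : Opens E} (h : V ≤ U) (f : SmoothFun U) :
    SmoothFun V :=
  ⟨(V : Set E).indicator f.1,
    (f.2.1.mono h).congr fun _ hx => Set.indicator_of_mem hx _,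
    fun _ hx => Set.indicator_of_notMem hx _⟩

/-- Multiplication by a smooth function. -/
noncomputable def mulOp {U : Opens E} (a : SmoothFun U) : SmoothFun U →ₗ[ℝ] SmoothFun U where
  toFun f := ⟨fun x => a.1 x * f.1 x, a.2.1.mul f.2.1, fun x hx => by simp [f.2.2 x hx]⟩
  map_add' f g := SmoothFun.ext fun x => mul_add (a.1 x) (f.1 x) (g.1 x)
  map_smul' c f := SmoothFun.ext fun x => mul_left_comm (a.1 x) c (f.1 x)

end Functions

/-- The derivation `D = d/dx` of `C^∞(I)`. -/
noncomputable def derivOp (I : Opens ℝ) : SmoothFun I →ₗ[ℝ] SmoothFun I where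
  toFun f := ⟨(I : Set ℝ).indicator (deriv f.1),
    (f.2.1.deriv_of_isOpen I.isOpen (m := ∞) (by simp)).congr
      fun _ hx => Set.indicator_of_mem hx _,
    fun _ hx => Set.indicator_of_notMem hx _⟩
  map_add' f g := by
    ext x
    change (I : Set ℝ).indicator (deriv (f.1 + g.1)) x =
      (I : Set ℝ).indicator (deriv f.1) x + (I : Set ℝ).indicator (deriv g.1) x
    by_cases hx : x ∈ (I : Set ℝ)
    · have hd : ∀ h : SmoothFun I, DifferentiableAt ℝ h.1 x := fun h =>
        (h.2.1.differentiableOn (by simp)).differentiableAt (I.isOpen.mem_nhds hx)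
      simp only [Set.indicator_of_mem hx, deriv_add (hd f) (hd g)]
    · simp only [Set.indicator_of_notMem hx, add_zero]
  map_smul' c f := by
    ext x
    change (I : Set ℝ).indicator (deriv (c • f.1)) x = c * (I : Set ℝ).indicator (deriv f.1) x
    by_cases hx : x ∈ (I : Set ℝ)
    · have hd : DifferentiableAt ℝ f.1 x :=
        (f.2.1.differentiableOn (by simp)).differentiableAt (I.isOpen.mem_nhds hx)
      simp only [Set.indicator_of_mem hx, deriv_const_smul c hd, smul_eq_mul]
    · simp only [Set.indicator_of_notMem hx, mul_zero]

/-- The open rectangle `I × J`. -/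
def openRect (I J : Opens ℝ) : Opens (ℝ × ℝ) :=
  ⟨(I : Set ℝ) ×ˢ (J : Set ℝ), I.isOpen.prod J.isOpen⟩

/-- A function `φ(x)` of `x` alone, regarded as a function of `(x, y)` on `I × J`. -/
noncomputable def pullOp (I J : Opens ℝ) : SmoothFun I →ₗ[ℝ] SmoothFun (openRect I J) where
  toFun f := ⟨(openRect I J : Set (ℝ × ℝ)).indicator fun z => f.1 z.1,
    (f.2.1.comp contDiff_fst.contDiffOn fun _ hz => hz.1).congr
      fun _ hz => Set.indicator_of_mem hz _,
    fun _ hz => Set.indicator_of_notMem hz _⟩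
  map_add' f g := SmoothFun.ext fun z =>
    congrFun (Set.indicator_add (openRect I J : Set (ℝ × ℝ)) (fun z => f.1 z.1) fun z => g.1 z.1) z
  map_smul' c f := SmoothFun.ext fun z =>
    congrFun (Set.indicator_const_smul (openRect I J : Set (ℝ × ℝ)) c fun z => f.1 z.1) z

/-- The substitution of a point `y ∈ J` for the second variable: `f(x, y) ↦ f(·, y)`. -/
noncomputable def evalOp {I J : Opens ℝ} (y : J) : SmoothFun (openRect I J) →ₗ[ℝ] SmoothFun I where
  toFun f := ⟨fun x => f.1 (x, y),
    f.2.1.comp (contDiff_id.prodMk contDiff_const).contDiffOn fun _ hx => ⟨hx, y.2⟩,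
    fun _ hx => f.2.2 _ fun h => hx h.1⟩
  map_add' _ _ := rfl
  map_smul' _ _ := rfl

/-- Maps among which the operators `R(x)` live. -/
abbrev LineMap (I : Opens ℝ) := SmoothFun I →ₗ[ℝ] SmoothFun I

/-- Maps among which the operators `L(x, y)` live.  A product `M(x, y) R(x)` is `M ∘ₗ R`, the
specialization `L(x, y₀)` is `evalOp y₀ ∘ₗ L`. -/
abbrev PlaneMap (I J : Opens ℝ) := SmoothFun I →ₗ[ℝ] SmoothFun (openRect I J)

/-- The ordinary differential operator `c₀(x) + c₁(x) D + ⋯ + cₙ(x) Dⁿ`. -/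
noncomputable def lineOp {I : Opens ℝ} (n : ℕ) (c : Fin (n + 1) → SmoothFun I) : LineMap I :=
  ∑ j : Fin (n + 1), mulOp (c j) ∘ₗ (derivOp I ^ (j : ℕ))

/-- The ordinary differential operator `a₀(x, y) + a₁(x, y) D + ⋯ + aₙ(x, y) Dⁿ`, `D = d/dx`. -/
noncomputable def planeOp {I J : Opens ℝ} (n : ℕ) (a : Fin (n + 1) → SmoothFun (openRect I J)) :
    PlaneMap I J :=
  ∑ j : Fin (n + 1), mulOp (a j) ∘ₗ pullOp I J ∘ₗ (derivOp I ^ (j : ℕ))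

/-- `R` is a linear ordinary differential operator `R(x)`. -/
def IsLineOp {I : Opens ℝ} (R : LineMap I) : Prop := ∃ n c, R = lineOp n c

/-- `L` is a linear ordinary differential operator `L(x, y)` in `x`. -/
def IsPlaneOp {I J : Opens ℝ} (L : PlaneMap I J) : Prop := ∃ n a, L = planeOp n a

/-- `R` is a differential operator `R(x)` whose leading coefficient vanishes nowhere on `I`. -/
def IsRegularLineOp {I : Opens ℝ} (R : LineMap I) : Prop :=
  ∃ (n : ℕ) (c : Fin (n + 1) → SmoothFun I),
    R = lineOp n c ∧ ∀ x ∈ I, (c (Fin.last n)).1 x ≠ 0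

/-- The order of a differential operator `R(x)`. -/
noncomputable def opOrder {I : Opens ℝ} (R : LineMap I) : ℕ :=
  sInf {n | ∃ c : Fin (n + 1) → SmoothFun I, R = lineOp n c}

/-- The operator row of the multiintegral with coefficients `a i j` (of `φᵢ^{(j)}`, `0 ≤ j ≤ nᵢ`)
on an open rectangle `I × J` inside the common domain `U` of the coefficients. -/
noncomputable def operatorRow {U : Opens (ℝ × ℝ)} {k : ℕ} {n : Fin k → ℕ}
    (a : (i : Fin k) → Fin (n i + 1) → SmoothFun U) (I J : Opens ℝ) (h : openRect I J ≤ U)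
    (i : Fin k) : PlaneMap I J :=
  planeOp (n i) fun j => SmoothFun.restrict h (a i j)

/-- The kernel of the multiintegral `L₁ φ₁ + ⋯ + Lₖ φₖ`: all columns `(φ₁(x), …, φₖ(x))` of smooth
functions on `I` for which it vanishes identically on `I × J`. -/
noncomputable def multiKer {I J : Opens ℝ} {k : ℕ} (L : Fin k → PlaneMap I J) :
    Submodule ℝ (Fin k → SmoothFun I) :=
  LinearMap.ker (∑ i, L i ∘ₗ LinearMap.proj i)

/-- For points and operators `w = [(y₁, P₁), …, (yₛ, Pₛ)]`, the operator
`P₁(x) N(x, y₁) + ⋯ + Pₛ(x) N(x, yₛ)`. -/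
noncomputable def pointComb {I J : Opens ℝ} (w : List (J × LineMap I)) (N : PlaneMap I J) : LineMap I :=
  (w.map fun u => u.2 ∘ₗ evalOp u.1 ∘ₗ N).sum

/-- `(K, R, w)` is an output of the algorithm **RI** on the operator `N(x, y)`:
`w = [(y₁, P₁), …, (yₛ, Pₛ)]` lists the points used and the operators obtained by reverse
substitution in the Euclidean algorithm, `R(x) = ∑ Pᵢ(x) N(x, yᵢ)` is the right greatest common
divisor of `N(x, y₁), …, N(x, yₛ)`, and the algorithm stops since `R(x)` is a right divisor
of `N(x, y)` itself, `N(x, y) = K(x, y) R(x)`.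
(The last two equations also say that `R(x)` right divides every `N(x, yᵢ)`, and that
`∑ Pᵢ(x) K(x, yᵢ) = 1`.) -/
structure IsRIOutput {I J : Opens ℝ} (N K : PlaneMap I J) (R : LineMap I)
    (w : List (J × LineMap I)) : Prop where
  isPlaneOp : IsPlaneOp K
  isLineOp : ∀ u ∈ w, IsLineOp u.2
  regular : IsRegularLineOp R
  gcd : R = pointComb w N
  factor : N = K ∘ₗ R

/-- A complete run of the algorithm **RMI** on the operator row `L`, carried out on `I × J`.

The columns are processed from left to right. `q i` is the column in which the `i`-th row (pivot)
is created, so that the rows available when column `j` is processed are those with `q i < j`.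
`K i` and `w i` are the irreducible operator and the points and operators which **RI** returned
for that row. `T i j` is the coefficient found by elimination, so that
`L j = ∑ᵢ K i ∘ T i j`. `S l i` (`l < i`) are the arbitrarily chosen operators. -/
structure IsRMIRun {I J : Opens ℝ} {k p : ℕ} (L : Fin k → PlaneMap I J)
    (q : Fin p → Fin k) (K : Fin p → PlaneMap I J) (w : Fin p → List (J × LineMap I))
    (T : Matrix (Fin p) (Fin k) (LineMap I)) (S : Matrix (Fin p) (Fin p) (LineMap I))
    (M : Fin p → PlaneMap I J) (R : Matrix (Fin p) (Fin k) (LineMap I)) : Prop where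
  strictMono : StrictMono q
  /-- No entries to the left of a pivot. -/
  left_zero : ∀ i j, j < q i → T i j = 0
  /-- Elimination in column `j` by the `i`-th row, after elimination by the rows before it. -/
  eliminate : ∀ i j, q i < j →
    T i j = pointComb (w i) (L j - ∑ l ∈ Finset.Iio i, K l ∘ₗ T l j)
  /-- Stage A: if the remainder is non-zero, **RI** is applied to it and gives a new row. -/
  pivot : ∀ i,
    IsRIOutput (L (q i) - ∑ l ∈ Finset.Iio i, K l ∘ₗ T l (q i)) (K i) (T i (q i)) (w i)
  /-- If the remainder vanishes, no new row is created. -/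
  no_pivot : ∀ j, j ∉ Set.range q → L j - ∑ l, K l ∘ₗ T l j = 0
  isLineOp : ∀ l i, IsLineOp (S l i)
  /-- Stage B. -/
  stageB : ∀ i j, R i j = T i j - ∑ l ∈ Finset.Ioi i, S i l ∘ₗ T l j
  /-- Stage C. -/
  stageC : ∀ i, M i = K i + ∑ l ∈ Finset.Iio i, M l ∘ₗ S l i

/-- The row `M(x, y)` (of length `p`) and the `p × k` echelon matrix `R(x)` are obtained from the
operator row `L(x, y)` (of length `k`) by some run of the algorithm **RMI** on `I × J`. -/
def IsRMIOutput {I J : Opens ℝ} {k p : ℕ} (L : Fin k → PlaneMap I J)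
    (M : Fin p → PlaneMap I J) (R : Matrix (Fin p) (Fin k) (LineMap I)) : Prop :=
  ∃ q K w T S, IsRMIRun L q K w T S M R

/-! Part (b). Let C_i be the map f ↦ ∑_a P_{i,a} f(·, y_{i,a}) attached to row i (`combOp`).
Elimination yields L_j = ∑_l K_l T_lj, so 𝒥φ = ∑_l K_l (Tφ)_l. The elimination rule, read in the
pivot columns, forces C_i K_i = 1 and C_i K_l = 0 for l > i, because pivots are surjective on C^∞(I)
and can be cancelled on the right. The row (K_l) is therefore injective on columns of functions of
x, and ker 𝒥 = ker T (`ker_eq_ker_matrixMap`).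

An operator whose leading coefficient has no zeros is surjective on C^∞(I), with kernel of dimension
equal to its order (`IsRegularOfOrder.exists_solution`, `IsRegularOfOrder.nonempty_equiv`). Back
substitution solves the echelon system Tφ = 0: a column without pivot carries an arbitrary smooth
function, so p < k gives an infinite-dimensional kernel; for p = k the dimensions of the diagonal
kernels add up (`infinite_ker_matrixMap`, `finrank_ker_matrixMap`). In the square case stage B
leaves the diagonal unchanged.

Part (a). Among all left combinations of values N(x, y_a) that become regular on some subinterval,
take one, R, of least order. The remainder of N on right division by R vanishes: otherwise its value
at some y would be a non-zero combination of smaller order, regular on a still smaller interval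
(`exists_isRIOutput`). RMI follows by induction on the columns, each new shrinking of I being
compatible with the data found before; J is never shrunk. -/

/-! ### Linear differential equations: existence, uniqueness, smoothness -/

section LinearODE

variable {F : Type*} [NormedAddCommGroup F] [NormedSpace ℝ F]

/-- The terms of the Picard series of the linear equation `u' = A u + b`, `u x₀ = w`. -/
noncomputable def picardTerm (A : ℝ → F →L[ℝ] F) (b : ℝ → F) (x₀ : ℝ) (w : F) : ℕ → ℝ → F
  | 0 => fun x => w + ∫ t in x₀..x, b t
  | m + 1 => fun x => ∫ t in x₀..x, A t (picardTerm A b x₀ w m t)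

theorem hasDerivAt_integral_of_continuousOn [CompleteSpace F] {s : Set ℝ} (hs : IsOpen s)
    (hs' : s.OrdConnected) {f : ℝ → F} (hf : ContinuousOn f s) {x₀ x : ℝ} (hx₀ : x₀ ∈ s) (hx : x ∈ s) :
    HasDerivAt (fun y => ∫ t in x₀..y, f t) (f x) x :=
  intervalIntegral.integral_hasDerivAt_right
    ((hf.mono (hs'.uIcc_subset hx₀ hx)).intervalIntegrable)
    (hf.stronglyMeasurableAtFilter hs x hx) (hf.continuousAt (hs.mem_nhds hx))

theorem continuousOn_picardTerm [CompleteSpace F] {s : Set ℝ} (hs : IsOpen s)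
    (hs' : s.OrdConnected)
    {A : ℝ → F →L[ℝ] F} {b : ℝ → F} (hA : ContinuousOn A s) (hb : ContinuousOn b s)
    {x₀ : ℝ} (hx₀ : x₀ ∈ s) (w : F) (m : ℕ) : ContinuousOn (picardTerm A b x₀ w m) s := by
  induction m with
  | zero =>
    exact fun x hx => ((hasDerivAt_integral_of_continuousOn hs hs' hb hx₀ hx).const_add
      w).continuousAt.continuousWithinAt
  | succ m ih =>
    exact fun x hx => (hasDerivAt_integral_of_continuousOn hs hs' (hA.clm_apply ih)
      hx₀ hx).continuousAt.continuousWithinAt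

theorem hasDerivAt_picardTerm_succ [CompleteSpace F] {s : Set ℝ} (hs : IsOpen s)
    (hs' : s.OrdConnected)
    {A : ℝ → F →L[ℝ] F} {b : ℝ → F} (hA : ContinuousOn A s) (hb : ContinuousOn b s)
    {x₀ : ℝ} (hx₀ : x₀ ∈ s) (w : F) (m : ℕ) {x : ℝ} (hx : x ∈ s) :
    HasDerivAt (picardTerm A b x₀ w (m + 1)) (A x (picardTerm A b x₀ w m x)) x :=
  hasDerivAt_integral_of_continuousOn hs hs'
    (hA.clm_apply (continuousOn_picardTerm hs hs' hA hb hx₀ w m)) hx₀ hx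

/-- Integrating |t - x₀|^m contributes a factor 1/(m + 1) each time. The resulting factorial makes
the Picard series converge on the whole set where `A` is bounded, with no restriction on its length.
-/
theorem norm_picardTerm_le {A : ℝ → F →L[ℝ] F} {b : ℝ → F} {x₀ : ℝ} {w : F} {s : Set ℝ}
    (hs : s.OrdConnected) (hx₀ : x₀ ∈ s) {C M : ℝ} (hC : ∀ x ∈ s, ‖A x‖ ≤ C)
    (hM : ∀ x ∈ s, ‖picardTerm A b x₀ w 0 x‖ ≤ M) (m : ℕ) :
    ∀ x ∈ s, ‖picardTerm A b x₀ w m x‖ ≤ M * ((C * |x - x₀|) ^ m / m.factorial) := by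
  have hC0 : 0 ≤ C := (norm_nonneg _).trans (hC x₀ hx₀)
  have hM0 : 0 ≤ M := (norm_nonneg _).trans (hM x₀ hx₀)
  induction m with
  | zero => simpa using hM
  | succ m ih =>
    intro x hx
    calc ‖picardTerm A b x₀ w (m + 1) x‖
        ≤ ∫ t in Set.uIoc x₀ x, M * C ^ (m + 1) / m.factorial * |t - x₀| ^ m := by
          rw [picardTerm, intervalIntegral.norm_intervalIntegral_eq]
          refine MeasureTheory.norm_integral_le_of_norm_le
            (Continuous.integrableOn_uIoc (by fun_prop)) ?_
          refine (MeasureTheory.ae_restrict_mem measurableSet_uIoc).mono fun t ht => ?_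
          have hts : t ∈ s := hs.uIcc_subset hx₀ hx (Set.uIoc_subset_uIcc ht)
          calc ‖A t (picardTerm A b x₀ w m t)‖
              ≤ C * (M * ((C * |t - x₀|) ^ m / m.factorial)) :=
                (A t).le_of_opNorm_le_of_le (hC t hts) (ih t hts)
            _ = _ := by rw [mul_pow]; ring
      _ = _ := by
          rw [MeasureTheory.integral_const_mul, integral_pow_abs_sub_uIoc, mul_pow,
            Nat.factorial_succ]
          push_cast
          have : (m.factorial : ℝ) ≠ 0 := by positivity
          field_simp

/-- The coefficients may be unbounded on `s`; estimates are made on a compact interval having both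
the initial point and the point of interest in its interior. -/
theorem exists_Icc_subset_of_mem {s : Set ℝ} (hs : IsOpen s) (hs' : s.OrdConnected) {x y : ℝ}
    (hx : x ∈ s) (hy : y ∈ s) :
    ∃ α β : ℝ, Set.Icc α β ⊆ s ∧ x ∈ Set.Ioo α β ∧ y ∈ Set.Ioo α β := by
  have key : ∀ z ∈ s, ∃ ε > 0, z - ε ∈ s ∧ z + ε ∈ s := by
    intro z hz
    obtain ⟨ε, hε, h⟩ := Metric.isOpen_iff.1 hs z hz
    refine ⟨ε / 2, by positivity, h ?_, h ?_⟩ <;>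
      simp [abs_of_pos hε] <;> linarith
  obtain ⟨ε, hε, h1, h2⟩ := key _ (show min x y ∈ s by rcases min_choice x y with h | h <;> rwa [h])
  obtain ⟨δ, hδ, h3, h4⟩ := key _ (show max x y ∈ s by rcases max_choice x y with h | h <;> rwa [h])
  refine ⟨min x y - ε, max x y + δ, hs'.out h1 h4, ⟨?_, ?_⟩, ?_, ?_⟩
  · linarith [min_le_left x y]
  · linarith [le_max_left x y]
  · linarith [min_le_right x y]
  · linarith [le_max_right x y]

/-- Global existence for linear differential equations on an open interval. -/
theorem exists_hasDerivAt_linear [CompleteSpace F] {s : Set ℝ} (hs : IsOpen s)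
    (hs' : s.OrdConnected)
    {A : ℝ → F →L[ℝ] F} {b : ℝ → F} (hA : ContinuousOn A s) (hb : ContinuousOn b s)
    {x₀ : ℝ} (hx₀ : x₀ ∈ s) (w : F) :
    ∃ u : ℝ → F, u x₀ = w ∧ ∀ x ∈ s, HasDerivAt u (A x (u x) + b x) x := by
  set P := picardTerm A b x₀ w with hP
  have hP0 : ∀ m, P (m + 1) x₀ = 0 := fun m => intervalIntegral.integral_same
  -- The zeroth term is kept apart: it alone carries the initial value and the inhomogeneity `b`,
  -- while all later terms vanish at `x₀` and satisfy P_{m+1}' = A P_m.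
  refine ⟨fun x => P 0 x + ∑' m, P (m + 1) x, ?_, fun x hx => ?_⟩
  · simp [hP, picardTerm]
  · obtain ⟨α, β, hsub, h1, h2⟩ := exists_Icc_subset_of_mem hs hs' hx₀ hx
    obtain ⟨C, hC⟩ := isCompact_Icc.exists_bound_of_continuousOn (hA.mono hsub)
    obtain ⟨M, hM⟩ := isCompact_Icc.exists_bound_of_continuousOn
      ((continuousOn_picardTerm hs hs' hA hb hx₀ w 0).mono hsub)
    have hx₀' : x₀ ∈ Set.Icc α β := Set.Ioo_subset_Icc_self h1
    have hC0 : 0 ≤ C := (norm_nonneg _).trans (hC x₀ hx₀')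
    have hM0 : 0 ≤ M := (norm_nonneg _).trans (hM x₀ hx₀')
    have hbd : ∀ m, ∀ y ∈ Set.Icc α β,
        ‖P m y‖ ≤ M * ((C * (β - α)) ^ m / m.factorial) := by
      intro m y hy
      refine (norm_picardTerm_le Set.ordConnected_Icc hx₀' hC hM m y hy).trans ?_
      have : |y - x₀| ≤ β - α := by
        rw [abs_le]; constructor <;> linarith [hy.1, hy.2, hx₀'.1, hx₀'.2]
      gcongr
    have hsum : Summable fun m : ℕ => M * ((C * (β - α)) ^ m / m.factorial) :=
      (Real.summable_pow_div_factorial _).mul_left M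
    have hPs : Summable fun m => P m x :=
      .of_norm_bounded hsum fun m => hbd m x (Set.Ioo_subset_Icc_self h2)
    have hd : HasDerivAt (fun y => ∑' m, P (m + 1) y) (∑' m, A x (P m x)) x := by
      refine hasDerivAt_tsum_of_isPreconnected (hsum.mul_left C) isOpen_Ioo
        (isPreconnected_Ioo (a := α) (b := β)) (fun m y hy =>
          hasDerivAt_picardTerm_succ hs hs' hA hb hx₀ w m (hsub (Set.Ioo_subset_Icc_self hy)))
        (fun m y hy => ?_) h1
        (show Summable fun m => P (m + 1) x₀ by simpa only [hP0] using summable_zero) h2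
      exact (A y).le_of_opNorm_le_of_le (hC y (Set.Ioo_subset_Icc_self hy))
        (hbd m y (Set.Ioo_subset_Icc_self hy))
    have h0 : HasDerivAt (P 0) (b x) x :=
      (hasDerivAt_integral_of_continuousOn hs hs' hb hx₀ hx).const_add w
    beta_reduce
    rw [← hPs.tsum_eq_zero_add, (A x).map_tsum hPs, add_comm]
    exact h0.add hd

/-- Uniqueness for linear differential equations on an open interval. -/
theorem eq_zero_of_hasDerivAt_linear {s : Set ℝ} (hs : IsOpen s) (hs' : s.OrdConnected)
    {A : ℝ → F →L[ℝ] F} (hA : ContinuousOn A s) {x₀ : ℝ} (hx₀ : x₀ ∈ s) {u : ℝ → F}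
    (hu : ∀ x ∈ s, HasDerivAt u (A x (u x)) x) (h0 : u x₀ = 0) : ∀ x ∈ s, u x = 0 := by
  intro x hx
  obtain ⟨α, β, hsub, h1, h2⟩ := exists_Icc_subset_of_mem hs hs' hx₀ hx
  obtain ⟨C, hC⟩ := isCompact_Icc.exists_bound_of_continuousOn (hA.mono hsub)
  refine ODE_solution_unique_of_mem_Ioo (v := fun t z => A t z) (s := fun _ => Set.univ)
    (K := C.toNNReal) (g := fun _ => 0) (fun t ht => ?_) h1 (fun t ht =>
      ⟨hu t (hsub (Set.Ioo_subset_Icc_self ht)), trivial⟩) (fun t _ =>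
      ⟨by simpa using hasDerivAt_const t (0 : F), trivial⟩) h0 h2
  refine ((A t).lipschitz.weaken ?_).lipschitzOnWith
  rw [← NNReal.coe_le_coe, coe_nnnorm]
  exact (hC t (Set.Ioo_subset_Icc_self ht)).trans (Real.le_coe_toNNReal C)

/-- Bootstrapping: if `u` is of class C^m, so is the right-hand side, hence `u` is of class C^(m+1).
-/
theorem contDiffOn_of_hasDerivAt_linear {s : Set ℝ} (hs : IsOpen s)
    {A : ℝ → F →L[ℝ] F} {b u : ℝ → F} (hA : ContDiffOn ℝ ∞ A s) (hb : ContDiffOn ℝ ∞ b s)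
    (hu : ∀ x ∈ s, HasDerivAt u (A x (u x) + b x) x) : ContDiffOn ℝ ∞ u s := by
  rw [contDiffOn_infty]
  intro m
  induction m with
  | zero => exact contDiffOn_zero.2 fun x hx => (hu x hx).continuousAt.continuousWithinAt
  | succ m ih =>
    rw [Nat.cast_succ, contDiffOn_succ_iff_deriv_of_isOpen hs]
    refine ⟨fun x hx => (hu x hx).differentiableAt.differentiableWithinAt, by simp, ?_⟩
    refine ContDiffOn.congr ?_ fun x hx => (hu x hx).deriv
    exact ((hA.of_le (mod_cast le_top)).clm_apply ih).add (hb.of_le (mod_cast le_top))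

end LinearODE

/-! ### Composition of linear maps with finite sums -/

section LinearMapSums

variable {V₁ V₂ V₃ ι : Type*} [AddCommGroup V₁] [Module ℝ V₁] [AddCommGroup V₂] [Module ℝ V₂]
  [AddCommGroup V₃] [Module ℝ V₃]

theorem linearMap_comp_sum (f : V₂ →ₗ[ℝ] V₃) (s : Finset ι) (g : ι → V₁ →ₗ[ℝ] V₂) :
    f ∘ₗ ∑ i ∈ s, g i = ∑ i ∈ s, f ∘ₗ g i :=
  LinearMap.ext fun x => by simp [LinearMap.sum_apply, map_sum]

theorem linearMap_sum_comp (s : Finset ι) (g : ι → V₂ →ₗ[ℝ] V₃) (f : V₁ →ₗ[ℝ] V₂) :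
    (∑ i ∈ s, g i) ∘ₗ f = ∑ i ∈ s, g i ∘ₗ f :=
  LinearMap.ext fun x => by simp [LinearMap.sum_apply]

end LinearMapSums

/-! ### The algebra of differential operators: orders, coefficients, restriction -/

section OperatorAlgebra

variable {E : Type*} [NormedAddCommGroup E] [NormedSpace ℝ E] {W : Opens E} {I : Opens ℝ}

theorem SmoothFun.ext_on {f g : SmoothFun W} (h : ∀ z ∈ W, f.1 z = g.1 z) : f = g := by
  ext z
  by_cases hz : z ∈ W
  · exact h z hz
  · rw [f.2.2 z hz, g.2.2 z hz]

theorem SmoothFun.val_sum {ι : Type*} (s : Finset ι) (f : ι → SmoothFun W) (z : E) :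
    (∑ i ∈ s, f i).1 z = ∑ i ∈ s, (f i).1 z :=
  map_sum (⟨⟨fun f => f.1 z, rfl⟩, fun _ _ => rfl⟩ : SmoothFun W →+ ℝ) f s

@[simp] theorem SmoothFun.val_zero (z : E) : (0 : SmoothFun W).1 z = 0 := rfl

@[simp] theorem mulOp_apply (a f : SmoothFun W) (z : E) : (mulOp a f).1 z = a.1 z * f.1 z := rfl

theorem derivOp_apply (f : SmoothFun I) {x : ℝ} (hx : x ∈ I) :
    (derivOp I f).1 x = deriv f.1 x := Set.indicator_of_mem (s := (I : Set ℝ)) hx _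

theorem SmoothFun.differentiableAt (f : SmoothFun I) {x : ℝ} (hx : x ∈ I) :
    DifferentiableAt ℝ f.1 x :=
  (f.2.1.differentiableOn (by simp)).differentiableAt (I.isOpen.mem_nhds hx)

theorem mulOp_add (a b : SmoothFun W) : mulOp (a + b) = mulOp a + mulOp b :=
  LinearMap.ext fun f => SmoothFun.ext fun z => add_mul (a.1 z) (b.1 z) (f.1 z)

theorem mulOp_smul (r : ℝ) (a : SmoothFun W) : mulOp (r • a) = r • mulOp a :=
  LinearMap.ext fun f => SmoothFun.ext fun z => mul_assoc r (a.1 z) (f.1 z)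

@[simp] theorem mulOp_zero : mulOp (0 : SmoothFun W) = 0 :=
  LinearMap.ext fun f => SmoothFun.ext fun z => zero_mul (f.1 z)

theorem mulOp_comp_mulOp (a b : SmoothFun W) : mulOp a ∘ₗ mulOp b = mulOp (mulOp a b) :=
  LinearMap.ext fun f => SmoothFun.ext fun z => (mul_assoc (a.1 z) (b.1 z) (f.1 z)).symm

theorem derivOp_comp_mulOp (a : SmoothFun I) :
    derivOp I ∘ₗ mulOp a = mulOp (derivOp I a) + mulOp a ∘ₗ derivOp I := by
  refine LinearMap.ext fun f => SmoothFun.ext_on fun x hx => ?_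
  change (derivOp I (mulOp a f)).1 x = (derivOp I a).1 x * f.1 x + a.1 x * (derivOp I f).1 x
  rw [derivOp_apply _ hx, derivOp_apply _ hx, derivOp_apply _ hx]
  exact deriv_mul (a.differentiableAt hx) (f.differentiableAt hx)

/-- The constant function `1`. -/
noncomputable def SmoothFun.one (W : Opens E) : SmoothFun W :=
  ⟨(W : Set E).indicator fun _ => 1,
    contDiffOn_const.congr fun _ hx => Set.indicator_of_mem hx _,
    fun _ hx => Set.indicator_of_notMem hx _⟩

theorem SmoothFun.one_apply {z : E} (hz : z ∈ W) : (SmoothFun.one W).1 z = 1 :=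
  Set.indicator_of_mem (s := (W : Set E)) hz fun _ => (1 : ℝ)

theorem mulOp_one : mulOp (SmoothFun.one W) = LinearMap.id :=
  LinearMap.ext fun f => SmoothFun.ext_on fun z hz => by
    simp [SmoothFun.one_apply hz]

/-- The reciprocal of a smooth function without zeros. -/
noncomputable def SmoothFun.inv (c : SmoothFun W) (hc : ∀ z ∈ W, c.1 z ≠ 0) : SmoothFun W :=
  ⟨fun z => (c.1 z)⁻¹, c.2.1.inv hc, fun z hz => by simp [c.2.2 z hz]⟩

/-- `ρ` is the pull-back of functions along `π : W → I`. -/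
structure IsPullback (ρ : SmoothFun I →ₗ[ℝ] SmoothFun W) (π : E → ℝ) : Prop where
  mapsTo : ∀ z ∈ W, π z ∈ I
  apply : ∀ f, ∀ z ∈ W, (ρ f).1 z = f.1 (π z)

/-- The identity and `pullOp` are the two cases of interest; a statement about a general pull-back
covers operators R(x) and L(x, y) at once. -/
theorem isPullback_id : IsPullback (LinearMap.id : LineMap I) id := ⟨fun _ h => h, fun _ _ _ => rfl⟩

theorem isPullback_pullOp (I J : Opens ℝ) : IsPullback (pullOp I J) Prod.fst :=
  ⟨fun _ h => h.1, fun f _ hz =>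
    Set.indicator_of_mem (s := (openRect I J : Set (ℝ × ℝ))) hz fun z => f.1 z.1⟩

theorem IsPullback.comp_mulOp {ρ : SmoothFun I →ₗ[ℝ] SmoothFun W} {π : E → ℝ}
    (h : IsPullback ρ π) (c : SmoothFun I) : ρ ∘ₗ mulOp c = mulOp (ρ c) ∘ₗ ρ :=
  LinearMap.ext fun f => SmoothFun.ext_on fun z hz => by
    simp [h.apply _ z hz]

/-- The operators `∑_{j < n} a_j D^j` of order less than `n`; functions of `x` are regarded as
functions on `W` by means of `ρ`. -/
def ordLT (ρ : SmoothFun I →ₗ[ℝ] SmoothFun W) (n : ℕ) :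
    Submodule ℝ (SmoothFun I →ₗ[ℝ] SmoothFun W) where
  carrier := {A | ∃ a : ℕ → SmoothFun W,
    A = ∑ j ∈ Finset.range n, mulOp (a j) ∘ₗ ρ ∘ₗ (derivOp I ^ j)}
  add_mem' := by
    rintro _ _ ⟨a, rfl⟩ ⟨b, rfl⟩
    exact ⟨a + b, by simp [mulOp_add, LinearMap.add_comp, Finset.sum_add_distrib]⟩
  zero_mem' := ⟨0, by simp⟩
  smul_mem' := by
    rintro r _ ⟨a, rfl⟩
    exact ⟨r • a, by simp [mulOp_smul, LinearMap.smul_comp, Finset.smul_sum]⟩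

variable {ρ : SmoothFun I →ₗ[ℝ] SmoothFun W} {π : E → ℝ} {n m : ℕ}
  {A : SmoothFun I →ₗ[ℝ] SmoothFun W}

theorem monomial_mem_ordLT (c : SmoothFun W) {j : ℕ} (hj : j < n) :
    mulOp c ∘ₗ ρ ∘ₗ (derivOp I ^ j) ∈ ordLT ρ n := by
  refine ⟨Pi.single j c, ?_⟩
  rw [Finset.sum_eq_single_of_mem j (Finset.mem_range.2 hj)]
  · simp
  · intro i _ hi
    simp [Pi.single_eq_of_ne hi]

theorem monomial_mem_ordLT_id (c : SmoothFun I) {j : ℕ} (hj : j < n) :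
    mulOp c ∘ₗ (derivOp I ^ j) ∈ ordLT (LinearMap.id : LineMap I) n :=
  monomial_mem_ordLT (ρ := LinearMap.id) c hj

theorem ordLT_mono (h : n ≤ m) : ordLT ρ n ≤ ordLT ρ m := by
  rintro _ ⟨a, rfl⟩
  exact sum_mem fun j hj => monomial_mem_ordLT _ ((Finset.mem_range.1 hj).trans_le h)

theorem ordLT_zero_eq (hA : A ∈ ordLT ρ 0) : A = 0 := by
  obtain ⟨a, rfl⟩ := hA
  simp

theorem mulOp_comp_mem_ordLT (c : SmoothFun W) (hA : A ∈ ordLT ρ n) :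
    mulOp c ∘ₗ A ∈ ordLT ρ n := by
  obtain ⟨a, rfl⟩ := hA
  rw [linearMap_comp_sum]
  refine sum_mem fun j hj => ?_
  rw [← LinearMap.comp_assoc, mulOp_comp_mulOp]
  exact monomial_mem_ordLT _ (Finset.mem_range.1 hj)

theorem IsPullback.comp_mem_ordLT (h : IsPullback ρ π) {R : LineMap I}
    (hR : R ∈ ordLT (LinearMap.id : LineMap I) n) : ρ ∘ₗ R ∈ ordLT ρ n := by
  obtain ⟨a, rfl⟩ := hR
  rw [linearMap_comp_sum]
  refine sum_mem fun j hj => ?_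
  rw [← LinearMap.comp_assoc, h.comp_mulOp]
  exact monomial_mem_ordLT _ (Finset.mem_range.1 hj)

/-- By the Leibniz rule, D ∘ aD^j = a'D^j + aD^(j+1). -/
theorem derivOp_comp_mem_ordLT {R : LineMap I} (hR : R ∈ ordLT (LinearMap.id : LineMap I) n) :
    derivOp I ∘ₗ R ∈ ordLT (LinearMap.id : LineMap I) (n + 1) := by
  obtain ⟨a, rfl⟩ := hR
  rw [linearMap_comp_sum]
  refine sum_mem fun j hj => ?_
  have hj := Finset.mem_range.1 hj
  rw [← LinearMap.comp_assoc, derivOp_comp_mulOp, LinearMap.add_comp]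
  refine add_mem (monomial_mem_ordLT _ (hj.trans (Nat.lt_succ_self n))) ?_
  rw [LinearMap.comp_assoc, LinearMap.id_comp]
  have : derivOp I ∘ₗ (derivOp I ^ j) = derivOp I ^ (j + 1) := (pow_succ' _ _).symm
  rw [this]
  exact monomial_mem_ordLT_id _ (Nat.succ_lt_succ hj)

theorem derivOp_pow_succ_comp (j : ℕ) (R : LineMap I) :
    (derivOp I ^ (j + 1)) ∘ₗ R = derivOp I ∘ₗ ((derivOp I ^ j) ∘ₗ R) := by
  rw [pow_succ', Module.End.mul_eq_comp, LinearMap.comp_assoc]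

theorem derivOp_pow_comp_mem_ordLT {R : LineMap I}
    (hR : R ∈ ordLT (LinearMap.id : LineMap I) n) (j : ℕ) :
    (derivOp I ^ j) ∘ₗ R ∈ ordLT (LinearMap.id : LineMap I) (n + j) := by
  induction j with
  | zero => exact hR
  | succ j ih =>
    rw [derivOp_pow_succ_comp]
    exact derivOp_comp_mem_ordLT ih

/-- Composition with a power of `D` keeps the leading coefficient. -/
theorem derivOp_pow_comp_sub_mem_ordLT {R : LineMap I} {c : SmoothFun I}
    (hR : R - mulOp c ∘ₗ (derivOp I ^ m) ∈ ordLT (LinearMap.id : LineMap I) m) (j : ℕ) :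
    (derivOp I ^ j) ∘ₗ R - mulOp c ∘ₗ (derivOp I ^ (m + j)) ∈
      ordLT (LinearMap.id : LineMap I) (m + j) := by
  induction j with
  | zero => exact hR
  | succ j ih =>
    have h : (derivOp I ^ (j + 1)) ∘ₗ R - mulOp c ∘ₗ (derivOp I ^ (m + (j + 1))) =
        derivOp I ∘ₗ ((derivOp I ^ j) ∘ₗ R - mulOp c ∘ₗ (derivOp I ^ (m + j))) +
          mulOp (derivOp I c) ∘ₗ (derivOp I ^ (m + j)) := by
      rw [LinearMap.comp_sub, ← derivOp_pow_succ_comp, ← LinearMap.comp_assoc (derivOp I ^ (m + j)),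
        derivOp_comp_mulOp, LinearMap.add_comp, LinearMap.comp_assoc, ← add_assoc m,
        pow_succ' (derivOp I) (m + j), Module.End.mul_eq_comp]
      abel
    rw [h]
    exact add_mem (derivOp_comp_mem_ordLT ih)
      (monomial_mem_ordLT_id _ (by omega))

theorem IsPullback.comp_mem_ordLT_add (h : IsPullback ρ π) (hA : A ∈ ordLT ρ n) {R : LineMap I}
    (hR : R ∈ ordLT (LinearMap.id : LineMap I) m) : A ∘ₗ R ∈ ordLT ρ (m + n) := by
  obtain ⟨a, rfl⟩ := hA
  rw [linearMap_sum_comp]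
  refine sum_mem fun j hj => ?_
  have hj := Finset.mem_range.1 hj
  rw [LinearMap.comp_assoc, LinearMap.comp_assoc]
  exact mulOp_comp_mem_ordLT _ (h.comp_mem_ordLT
    (ordLT_mono (by omega) (derivOp_pow_comp_mem_ordLT hR j)))

theorem evalOp_comp_mem_ordLT {J : Opens ℝ} (y : J) {A : PlaneMap I J}
    (hA : A ∈ ordLT (pullOp I J) n) :
    evalOp y ∘ₗ A ∈ ordLT (LinearMap.id : LineMap I) n := by
  obtain ⟨a, rfl⟩ := hA
  rw [linearMap_comp_sum]
  refine sum_mem fun j hj => ?_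
  have : evalOp y ∘ₗ mulOp (a j) ∘ₗ pullOp I J ∘ₗ (derivOp I ^ j) =
      mulOp (evalOp y (a j)) ∘ₗ (derivOp I ^ j) := by
    refine LinearMap.ext fun f => SmoothFun.ext_on fun x hx => ?_
    change (a j).1 (x, y) * (pullOp I J _).1 (x, (y : ℝ)) = (a j).1 (x, y) * _
    rw [(isPullback_pullOp I J).apply _ _ ⟨hx, y.2⟩]
  rw [this]
  exact monomial_mem_ordLT_id _ (Finset.mem_range.1 hj)

/-- The shift by one arises since `lineOp n` has n + 1 coefficients, whereas `ordLT` also has a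
level 0, containing only the zero operator, from which inductions on the order start. -/
theorem mem_ordLT_succ_iff {R : LineMap I} :
    R ∈ ordLT (LinearMap.id : LineMap I) (n + 1) ↔
      ∃ c : Fin (n + 1) → SmoothFun I, R = lineOp n c := by
  constructor
  · rintro ⟨a, rfl⟩
    exact ⟨fun j => a j,
      (Fin.sum_univ_eq_sum_range (fun j => mulOp (a j) ∘ₗ (derivOp I ^ j)) (n + 1)).symm⟩
  · rintro ⟨c, rfl⟩
    exact sum_mem fun j _ => monomial_mem_ordLT_id _ j.2

theorem isLineOp_iff {R : LineMap I} :
    IsLineOp R ↔ ∃ n, R ∈ ordLT (LinearMap.id : LineMap I) n := by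
  constructor
  · rintro ⟨n, h⟩
    exact ⟨n + 1, mem_ordLT_succ_iff.2 h⟩
  · rintro ⟨n, h⟩
    exact ⟨n, mem_ordLT_succ_iff.1 (ordLT_mono (Nat.le_succ n) h)⟩

theorem isPlaneOp_iff {J : Opens ℝ} {A : PlaneMap I J} :
    IsPlaneOp A ↔ ∃ n, A ∈ ordLT (pullOp I J) n := by
  constructor
  · rintro ⟨n, c, rfl⟩
    exact ⟨n + 1, sum_mem fun j _ => monomial_mem_ordLT _ j.2⟩
  · rintro ⟨n, hR⟩
    obtain ⟨a, rfl⟩ := ordLT_mono (Nat.le_succ n) hR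
    exact ⟨n, fun j => a j,
      (Fin.sum_univ_eq_sum_range (fun j => mulOp (a j) ∘ₗ pullOp I J ∘ₗ (derivOp I ^ j))
        (n + 1)).symm⟩

/-- `R` has order `m`, and its leading coefficient has no zeros. -/
def IsRegularOfOrder (R : LineMap I) (m : ℕ) : Prop :=
  ∃ c : SmoothFun I, (∀ x ∈ I, c.1 x ≠ 0) ∧
    R - mulOp c ∘ₗ (derivOp I ^ m) ∈ ordLT (LinearMap.id : LineMap I) m

theorem isRegularLineOp_iff {R : LineMap I} :
    IsRegularLineOp R ↔ ∃ m, IsRegularOfOrder R m := by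
  constructor
  · rintro ⟨n, c, rfl, hc⟩
    refine ⟨n, c (Fin.last n), hc, ?_⟩
    rw [lineOp, Fin.sum_univ_castSucc, Fin.val_last, add_sub_cancel_right]
    exact sum_mem fun j _ => monomial_mem_ordLT_id _ j.2
  · rintro ⟨m, c, hc, a, ha⟩
    refine ⟨m, fun j => if (j : ℕ) < m then a j else c, ?_, by simpa using hc⟩
    rw [lineOp, Fin.sum_univ_castSucc, eq_add_of_sub_eq ha]
    congr 1
    · rw [← Fin.sum_univ_eq_sum_range (fun j => mulOp (a j) ∘ₗ LinearMap.id ∘ₗ (derivOp I ^ j)) m]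
      exact Finset.sum_congr rfl fun j _ => by simp
    · simp

theorem IsRegularOfOrder.mem_ordLT {R : LineMap I} (h : IsRegularOfOrder R m) :
    R ∈ ordLT (LinearMap.id : LineMap I) (m + 1) := by
  obtain ⟨c, -, h⟩ := h
  rw [← sub_add_cancel R (mulOp c ∘ₗ (derivOp I ^ m))]
  exact add_mem (ordLT_mono (Nat.le_succ m) h) (monomial_mem_ordLT_id _ (Nat.lt_succ_self m))

/-- The function `(x - x₀)ᵐ / m!`. -/
noncomputable def monomialFun (I : Opens ℝ) (x₀ : ℝ) (m : ℕ) : SmoothFun I :=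
  ⟨(I : Set ℝ).indicator fun x => (x - x₀) ^ m / m.factorial,
    (ContDiff.contDiffOn (by fun_prop)).congr fun _ hx => Set.indicator_of_mem hx _,
    fun _ hx => Set.indicator_of_notMem hx _⟩

theorem monomialFun_apply (x₀ : ℝ) (m : ℕ) {x : ℝ} (hx : x ∈ I) :
    (monomialFun I x₀ m).1 x = (x - x₀) ^ m / m.factorial :=
  Set.indicator_of_mem (s := (I : Set ℝ)) hx fun x => (x - x₀) ^ m / m.factorial

theorem derivOp_indicator_apply {f : SmoothFun I} {g : ℝ → ℝ} (h : ∀ x ∈ I, f.1 x = g x) {x : ℝ}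
    (hx : x ∈ I) : (derivOp I f).1 x = deriv g x := by
  rw [derivOp_apply _ hx]
  exact Filter.EventuallyEq.deriv_eq (Filter.eventually_of_mem (I.isOpen.mem_nhds hx) h)

theorem derivOp_monomialFun_zero (x₀ : ℝ) : derivOp I (monomialFun I x₀ 0) = 0 :=
  SmoothFun.ext_on fun x hx => by
    rw [derivOp_indicator_apply (fun x hx => monomialFun_apply x₀ 0 hx) hx]
    simp

theorem derivOp_monomialFun_succ (x₀ : ℝ) (m : ℕ) :
    derivOp I (monomialFun I x₀ (m + 1)) = monomialFun I x₀ m :=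
  SmoothFun.ext_on fun x hx => by
    rw [derivOp_indicator_apply (fun x hx => monomialFun_apply x₀ (m + 1) hx) hx,
      monomialFun_apply x₀ m hx]
    have h : HasDerivAt (fun x : ℝ => (x - x₀) ^ (m + 1) / (m + 1).factorial)
        ((↑(m + 1) * (x - x₀) ^ m * 1) / (m + 1).factorial) x :=
      (((hasDerivAt_id x).sub_const x₀).pow (m + 1)).div_const _
    rw [h.deriv, Nat.factorial_succ]
    have : (m.factorial : ℝ) ≠ 0 := by positivity
    push_cast
    field_simp

theorem derivOp_pow_monomialFun {x₀ : ℝ} (hx₀ : x₀ ∈ I) (j m : ℕ) :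
    ((derivOp I ^ j) (monomialFun I x₀ m)).1 x₀ = if j = m then 1 else 0 := by
  induction j generalizing m with
  | zero =>
    rw [pow_zero, Module.End.one_apply, monomialFun_apply x₀ m hx₀]
    cases m <;> simp
  | succ j ih =>
    rw [pow_succ, Module.End.mul_apply]
    cases m with
    | zero => rw [derivOp_monomialFun_zero, map_zero]; simp
    | succ m => rw [derivOp_monomialFun_succ, ih]; simp

/-- The monomials centred at `π z` are dual to the derivatives there, so they read off the
coefficients of an operator at `z`. All uniqueness statements for operators rest on this. -/
theorem IsPullback.sum_apply_monomialFun (h : IsPullback ρ π) (a : ℕ → SmoothFun W) (n m : ℕ)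
    {z : E} (hz : z ∈ W) :
    ((∑ j ∈ Finset.range n, mulOp (a j) ∘ₗ ρ ∘ₗ (derivOp I ^ j))
      (monomialFun I (π z) m)).1 z = if m < n then (a m).1 z else 0 := by
  rw [LinearMap.sum_apply, SmoothFun.val_sum]
  simp only [LinearMap.comp_apply, mulOp_apply, h.apply _ z hz,
    derivOp_pow_monomialFun (h.mapsTo z hz)]
  simp

theorem IsPullback.apply_monomialFun_eq_zero (h : IsPullback ρ π) (hA : A ∈ ordLT ρ n)
    (hm : n ≤ m) {z : E} (hz : z ∈ W) : (A (monomialFun I (π z) m)).1 z = 0 := by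
  obtain ⟨a, rfl⟩ := hA
  rw [h.sum_apply_monomialFun a n m hz, if_neg (by omega)]

/-- Restriction of functions, as a linear map. -/
noncomputable def resOp {U V : Opens E} (h : V ≤ U) : SmoothFun U →ₗ[ℝ] SmoothFun V where
  toFun := SmoothFun.restrict h
  map_add' f g := SmoothFun.ext fun z => congrFun (Set.indicator_add (V : Set E) f.1 g.1) z
  map_smul' c f := SmoothFun.ext fun z =>
    congrFun (Set.indicator_const_smul (V : Set E) c f.1) z

theorem resOp_apply {U V : Opens E} (h : V ≤ U) (f : SmoothFun U) {z : E} (hz : z ∈ V) :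
    (resOp h f).1 z = f.1 z := Set.indicator_of_mem (s := (V : Set E)) hz _

theorem resOp_comp_mulOp {U V : Opens E} (h : V ≤ U) (a : SmoothFun U) :
    resOp h ∘ₗ mulOp a = mulOp (resOp h a) ∘ₗ resOp h :=
  LinearMap.ext fun f => SmoothFun.ext_on fun z hz => by
    simp [resOp_apply h _ hz]

theorem resOp_comp_derivOp {I I' : Opens ℝ} (h : I' ≤ I) :
    resOp h ∘ₗ derivOp I = derivOp I' ∘ₗ resOp h :=
  LinearMap.ext fun f => SmoothFun.ext_on fun x hx => by
    simp only [LinearMap.comp_apply]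
    rw [resOp_apply h _ hx, derivOp_indicator_apply (fun x hx => resOp_apply h f hx) hx,
      derivOp_apply _ (h hx)]

theorem resOp_comp_derivOp_pow {I I' : Opens ℝ} (h : I' ≤ I) (j : ℕ) :
    resOp h ∘ₗ (derivOp I ^ j) = (derivOp I' ^ j) ∘ₗ resOp h := by
  induction j with
  | zero => rfl
  | succ j ih =>
    rw [pow_succ, pow_succ, Module.End.mul_eq_comp, Module.End.mul_eq_comp, ← LinearMap.comp_assoc,
      ih, LinearMap.comp_assoc, resOp_comp_derivOp, LinearMap.comp_assoc]

theorem resOp_monomialFun {I I' : Opens ℝ} (h : I' ≤ I) (x₀ : ℝ) (m : ℕ) :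
    resOp h (monomialFun I x₀ m) = monomialFun I' x₀ m :=
  SmoothFun.ext_on fun x hx => by
    rw [resOp_apply h _ hx, monomialFun_apply x₀ m hx, monomialFun_apply x₀ m (h hx)]

/-- A differential operator is determined by its values on restrictions of functions that are
smooth on a larger set. -/
theorem IsPullback.eq_zero_of_comp_resOp (hρ : IsPullback ρ π) {I₀ : Opens ℝ} (h : I ≤ I₀)
    (hA : A ∈ ordLT ρ n) (h0 : A ∘ₗ resOp h = 0) : A = 0 := by
  obtain ⟨a, rfl⟩ := hA
  refine Finset.sum_eq_zero fun m hm => ?_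
  have : a m = 0 := SmoothFun.ext_on fun z hz => by
    have h1 := hρ.sum_apply_monomialFun a n m hz
    rw [if_pos (Finset.mem_range.1 hm), ← resOp_monomialFun h, ← LinearMap.comp_apply _ (resOp h),
      h0] at h1
    exact h1.symm
  rw [this, mulOp_zero, LinearMap.zero_comp]

/-- The coefficients are restricted. Not every smooth function on `I'` extends to `I`, so the
intertwining relation does not by itself define `A'`; among differential operators it does determine
it, by `IsPullback.eq_zero_of_comp_resOp`. -/
theorem exists_restrict {I' : Opens ℝ} {W' : Opens E} (h : I' ≤ I) (hW : W' ≤ W)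
    {ρ' : SmoothFun I' →ₗ[ℝ] SmoothFun W'} (hρ : resOp hW ∘ₗ ρ = ρ' ∘ₗ resOp h)
    (hA : A ∈ ordLT ρ n) :
    ∃ A' ∈ ordLT ρ' n, A' ∘ₗ resOp h = resOp hW ∘ₗ A := by
  obtain ⟨a, rfl⟩ := hA
  refine ⟨_, ⟨fun j => resOp hW (a j), rfl⟩, ?_⟩
  rw [linearMap_comp_sum, linearMap_sum_comp]
  refine Finset.sum_congr rfl fun j _ => ?_
  rw [← LinearMap.comp_assoc _ _ (resOp hW), resOp_comp_mulOp, LinearMap.comp_assoc,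
    LinearMap.comp_assoc, LinearMap.comp_assoc, ← LinearMap.comp_assoc _ _ (resOp hW), hρ,
    LinearMap.comp_assoc, resOp_comp_derivOp_pow]

theorem resOp_comp_pullOp {I' J : Opens ℝ} (h : I' ≤ I) (hW : openRect I' J ≤ openRect I J) :
    resOp hW ∘ₗ pullOp I J = pullOp I' J ∘ₗ resOp h :=
  LinearMap.ext fun f => SmoothFun.ext_on fun z hz => by
    simp only [LinearMap.comp_apply]
    rw [resOp_apply hW _ hz, (isPullback_pullOp I J).apply _ z (hW hz),
      (isPullback_pullOp I' J).apply _ z hz, resOp_apply h _ hz.1]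

theorem resOp_comp_evalOp {I' J : Opens ℝ} (h : I' ≤ I) (hW : openRect I' J ≤ openRect I J)
    (y : J) : resOp h ∘ₗ evalOp y = evalOp y ∘ₗ resOp hW :=
  LinearMap.ext fun f => SmoothFun.ext_on fun x hx => by
    simp only [LinearMap.comp_apply]
    rw [resOp_apply h _ hx]
    exact (resOp_apply hW f (z := (x, (y : ℝ))) ⟨hx, y.2⟩).symm

end OperatorAlgebra

/-! ### Operators with nowhere vanishing leading coefficient: solvability and kernels -/

section RegularOperators

variable {I : Opens ℝ} {R : LineMap I} {n : ℕ} {x₀ : ℝ}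

/-- Applied to (x - x₀)^n / n! and evaluated at `x₀`, the operator gives its leading coefficient
there, which is non-zero; any operator of order below `n` gives 0. -/
theorem IsRegularOfOrder.opOrder_eq (hR : IsRegularOfOrder R n) (hx₀ : x₀ ∈ I) :
    opOrder R = n := by
  refine le_antisymm (Nat.sInf_le (mem_ordLT_succ_iff.1 hR.mem_ordLT))
    (le_csInf ⟨n, mem_ordLT_succ_iff.1 hR.mem_ordLT⟩ fun m hm => ?_)
  by_contra! hmn
  obtain ⟨c, hc, hR⟩ := hR
  have h1 := isPullback_id.apply_monomialFun_eq_zero (mem_ordLT_succ_iff.2 hm)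
    (Nat.succ_le_of_lt hmn) hx₀
  have h2 := isPullback_id.apply_monomialFun_eq_zero hR le_rfl hx₀
  have h3 := derivOp_pow_monomialFun hx₀ n n
  have h4 : (R (monomialFun I x₀ n)).1 x₀ -
      c.1 x₀ * ((derivOp I ^ n) (monomialFun I x₀ n)).1 x₀ = 0 := h2
  have h5 : (R (monomialFun I x₀ n)).1 x₀ = 0 := h1
  rw [h5, h3, if_pos rfl, zero_sub, mul_one, neg_eq_zero] at h4
  exact hc x₀ hx₀ h4

/-- The companion matrix of the equation `u⁽ᵐ⁺¹⁾ = ∑ gⱼ u⁽ʲ⁾`. -/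
noncomputable def companion {m : ℕ} (g : Fin (m + 1) → ℝ) :
    (Fin (m + 1) → ℝ) →L[ℝ] (Fin (m + 1) → ℝ) :=
  ContinuousLinearMap.pi fun i =>
    Fin.lastCases (∑ j, g j • ContinuousLinearMap.proj j)
      (fun i => ContinuousLinearMap.proj i.succ) i

theorem companion_last {m : ℕ} (g w : Fin (m + 1) → ℝ) :
    companion g w (Fin.last m) = ∑ j, g j * w j := by
  simp [companion]

theorem companion_castSucc {m : ℕ} (g w : Fin (m + 1) → ℝ) (i : Fin m) :
    companion g w i.castSucc = w i.succ := by
  simp [companion]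

theorem contDiffOn_companion {m : ℕ} {g : ℝ → Fin (m + 1) → ℝ} {s : Set ℝ}
    (hg : ∀ j, ContDiffOn ℝ ∞ (fun x => g x j) s) :
    ContDiffOn ℝ ∞ (fun x => companion (g x)) s := by
  rw [contDiffOn_clm_apply]
  intro w
  rw [contDiffOn_pi]
  intro i
  induction i using Fin.lastCases with
  | last =>
    simp only [companion_last]
    exact ContDiffOn.sum fun j _ => (hg j).mul contDiffOn_const
  | cast i =>
    simp only [companion_castSucc]
    exact contDiffOn_const

theorem hasDerivAt_derivOp_pow (u : SmoothFun I) (j : ℕ) {x : ℝ} (hx : x ∈ I) :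
    HasDerivAt ((derivOp I ^ j) u).1 (((derivOp I ^ (j + 1)) u).1 x) x := by
  rw [pow_succ', Module.End.mul_apply, derivOp_apply _ hx]
  exact (SmoothFun.differentiableAt _ hx).hasDerivAt

theorem hasDerivAt_jet {m : ℕ} (u : SmoothFun I) (g : Fin (m + 1) → ℝ) {x : ℝ} (hx : x ∈ I)
    (h : ((derivOp I ^ (m + 1)) u).1 x =
      ∑ j : Fin (m + 1), g j * ((derivOp I ^ (j : ℕ)) u).1 x) :
    HasDerivAt (fun x (j : Fin (m + 1)) => ((derivOp I ^ (j : ℕ)) u).1 x)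
      (companion g fun j => ((derivOp I ^ (j : ℕ)) u).1 x) x := by
  rw [hasDerivAt_pi]
  intro i
  induction i using Fin.lastCases with
  | last =>
    rw [companion_last, ← h]
    exact hasDerivAt_derivOp_pow u m hx
  | cast i =>
    rw [companion_castSucc]
    exact hasDerivAt_derivOp_pow u i hx

/-- A solution of the first order system gives a solution of the scalar equation. -/
theorem exists_smoothFun_of_hasDerivAt {m : ℕ} {g : ℝ → Fin (m + 1) → ℝ} {f : ℝ → ℝ}
    (hg : ∀ j, ContDiffOn ℝ ∞ (fun x => g x j) (I : Set ℝ)) (hf : ContDiffOn ℝ ∞ f (I : Set ℝ))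
    {w : ℝ → Fin (m + 1) → ℝ} (hw : ∀ x ∈ I,
      HasDerivAt w (companion (g x) (w x) + Pi.single (Fin.last m) (f x)) x) :
    ∃ u : SmoothFun I, (∀ x ∈ I, ∀ j : Fin (m + 1), ((derivOp I ^ (j : ℕ)) u).1 x = w x j) ∧
      ∀ x ∈ I, ((derivOp I ^ (m + 1)) u).1 x = ∑ j, g x j * w x j + f x := by
  have hws : ContDiffOn ℝ ∞ w (I : Set ℝ) :=
    contDiffOn_of_hasDerivAt_linear I.isOpen (contDiffOn_companion hg)
      (contDiffOn_pi.2 fun i => by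
        by_cases hi : i = Fin.last m
        · subst hi; simpa using hf
        · simpa [Pi.single_eq_of_ne hi] using contDiffOn_const) hw
  let u : SmoothFun I := ⟨(I : Set ℝ).indicator fun x => w x 0,
    ((contDiffOn_pi.1 hws) 0).congr fun _ hx => Set.indicator_of_mem hx _,
    fun _ hx => Set.indicator_of_notMem hx _⟩
  -- All rows of the companion system but the last say w_j' = w_(j+1), so the components of `w` are
  -- the successive derivatives of `u`.
  have hu : ∀ j : ℕ, ∀ hj : j < m + 1, ∀ x ∈ I, ((derivOp I ^ j) u).1 x = w x ⟨j, hj⟩ := by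
    intro j
    induction j with
    | zero => exact fun _ x hx => Set.indicator_of_mem (s := (I : Set ℝ)) hx fun x => w x 0
    | succ j ih =>
      intro hj x hx
      rw [pow_succ', Module.End.mul_apply, derivOp_indicator_apply (ih (by omega)) hx]
      have h := hasDerivAt_pi.1 (hw x hx) (Fin.castSucc ⟨j, by omega⟩)
      have hne : Fin.castSucc (⟨j, by omega⟩ : Fin m) ≠ Fin.last m := (Fin.castSucc_lt_last _).ne
      rw [Pi.add_apply, companion_castSucc, Pi.single_eq_of_ne hne, add_zero] at h
      exact h.deriv
  refine ⟨u, fun x hx j => hu j j.2 x hx, fun x hx => ?_⟩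
  rw [pow_succ', Module.End.mul_apply, derivOp_indicator_apply (hu m (Nat.lt_succ_self m)) hx]
  have h := hasDerivAt_pi.1 (hw x hx) (Fin.last m)
  rw [Pi.add_apply, companion_last, Pi.single_eq_same] at h
  exact h.deriv

theorem val_eq_of_sub_eq {c : SmoothFun I} {a : ℕ → SmoothFun I}
    (h : R - mulOp c ∘ₗ (derivOp I ^ n) =
      ∑ j ∈ Finset.range n, mulOp (a j) ∘ₗ LinearMap.id ∘ₗ (derivOp I ^ j))
    (u : SmoothFun I) (x : ℝ) :
    (R u).1 x = ∑ j : Fin n, (a j).1 x * ((derivOp I ^ (j : ℕ)) u).1 x +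
      c.1 x * ((derivOp I ^ n) u).1 x := by
  rw [eq_add_of_sub_eq h, Fin.sum_univ_eq_sum_range fun j => (a j).1 x * ((derivOp I ^ j) u).1 x,
    LinearMap.add_apply, SmoothFun.val_add, LinearMap.sum_apply, SmoothFun.val_sum]
  rfl

/-- Division by the leading coefficient turns the equation into a companion system. Order 0 is plain
division and is treated apart, the companion matrix having size at least one. -/
theorem IsRegularOfOrder.exists_solution (hR : IsRegularOfOrder R n) (hI : IsConnected (I : Set ℝ))
    (hx₀ : x₀ ∈ I) (f : SmoothFun I) (v : Fin n → ℝ) :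
    ∃ u, R u = f ∧ ∀ j : Fin n, ((derivOp I ^ (j : ℕ)) u).1 x₀ = v j := by
  obtain ⟨c, hc, a, ha⟩ := hR
  cases n with
  | zero =>
    refine ⟨mulOp (c.inv hc) f, SmoothFun.ext_on fun x hx => ?_, fun j => j.elim0⟩
    rw [val_eq_of_sub_eq ha]
    simp only [Finset.univ_eq_empty, Finset.sum_empty, zero_add, pow_zero, Module.End.one_apply,
      mulOp_apply]
    exact mul_inv_cancel_left₀ (hc x hx) _
  | succ m =>
    have hg : ∀ j : Fin (m + 1), ContDiffOn ℝ ∞ (fun x => -(a j).1 x / c.1 x) (I : Set ℝ) :=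
      fun j => (a j).2.1.neg.div c.2.1 hc
    have hf : ContDiffOn ℝ ∞ (fun x => f.1 x / c.1 x) (I : Set ℝ) := f.2.1.div c.2.1 hc
    obtain ⟨w, hw0, hw⟩ := exists_hasDerivAt_linear I.isOpen hI.isPreconnected.ordConnected
      (contDiffOn_companion hg).continuousOn
      (b := fun x => Pi.single (Fin.last m) (f.1 x / c.1 x))
      (continuousOn_pi.2 fun i => by
        by_cases hi : i = Fin.last m
        · subst hi; simpa using hf.continuousOn
        · simpa [Pi.single_eq_of_ne hi] using continuousOn_const) hx₀ v
    obtain ⟨u, hu, hu'⟩ := exists_smoothFun_of_hasDerivAt hg hf hw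
    refine ⟨u, SmoothFun.ext_on fun x hx => ?_, fun j => by rw [hu x₀ hx₀, hw0]⟩
    rw [val_eq_of_sub_eq ha, hu' x hx, mul_add, Finset.mul_sum, ← add_assoc,
      ← Finset.sum_add_distrib, mul_div_cancel₀ _ (hc x hx)]
    rw [Finset.sum_eq_zero, zero_add]
    intro j _
    rw [hu x hx]
    field_simp [hc x hx]
    ring

theorem IsRegularOfOrder.eq_zero_of_jet_eq_zero (hR : IsRegularOfOrder R n)
    (hI : IsConnected (I : Set ℝ)) (hx₀ : x₀ ∈ I) {u : SmoothFun I} (hu : R u = 0)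
    (h0 : ∀ j : Fin n, ((derivOp I ^ (j : ℕ)) u).1 x₀ = 0) : u = 0 := by
  obtain ⟨c, hc, a, ha⟩ := hR
  have hu' : ∀ x, ∑ j : Fin n, (a j).1 x * ((derivOp I ^ (j : ℕ)) u).1 x +
      c.1 x * ((derivOp I ^ n) u).1 x = 0 := fun x => by
    rw [← val_eq_of_sub_eq ha, hu, SmoothFun.val_zero]
  cases n with
  | zero =>
    refine SmoothFun.ext_on fun x hx => ?_
    simpa [hc x hx] using hu' x
  | succ m =>
    have hg : ∀ j : Fin (m + 1), ContDiffOn ℝ ∞ (fun x => -(a j).1 x / c.1 x) (I : Set ℝ) :=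
      fun j => (a j).2.1.neg.div c.2.1 hc
    have := eq_zero_of_hasDerivAt_linear I.isOpen hI.isPreconnected.ordConnected
      (contDiffOn_companion hg).continuousOn hx₀
      (u := fun x (j : Fin (m + 1)) => ((derivOp I ^ (j : ℕ)) u).1 x)
      (fun x hx => hasDerivAt_jet u _ hx ?_) (funext h0)
    · exact SmoothFun.ext_on fun x hx => congrFun (this x hx) 0
    · have h := eq_neg_of_add_eq_zero_right (hu' x)
      rw [← Finset.sum_neg_distrib] at h
      rw [← mul_right_inj' (hc x hx), h, Finset.mul_sum]
      refine Finset.sum_congr rfl fun j _ => ?_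
      field_simp [hc x hx]

theorem IsRegularOfOrder.surjective (hR : IsRegularOfOrder R n) (hI : IsConnected (I : Set ℝ)) :
    Function.Surjective R := fun f =>
  let ⟨_, hx₀⟩ := hI.nonempty
  let ⟨u, hu, _⟩ := hR.exists_solution hI hx₀ f 0
  ⟨u, hu⟩

/-- The derivatives of order less than `n` at `x₀`. -/
noncomputable def jet (I : Opens ℝ) (x₀ : ℝ) (n : ℕ) : SmoothFun I →ₗ[ℝ] Fin n → ℝ where
  toFun u j := ((derivOp I ^ (j : ℕ)) u).1 x₀
  map_add' u v := funext fun j => by rw [map_add]; rfl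
  map_smul' r u := funext fun j => by rw [map_smul]; rfl

/-- Existence and uniqueness for the initial value problem say that the jet at a point is a
bijection from the kernel onto ℝⁿ. -/
theorem IsRegularOfOrder.nonempty_equiv (hR : IsRegularOfOrder R n)
    (hI : IsConnected (I : Set ℝ)) : Nonempty (LinearMap.ker R ≃ₗ[ℝ] (Fin n → ℝ)) := by
  obtain ⟨x₀, hx₀⟩ := hI.nonempty
  refine ⟨LinearEquiv.ofBijective ((jet I x₀ n).domRestrict (LinearMap.ker R)) ⟨?_, fun v => ?_⟩⟩
  · rw [← LinearMap.ker_eq_bot, LinearMap.ker_eq_bot']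
    exact fun u hu => Subtype.ext (hR.eq_zero_of_jet_eq_zero hI hx₀ u.2 fun j => congrFun hu j)
  · obtain ⟨u, hu, hv⟩ := hR.exists_solution hI hx₀ 0 v
    exact ⟨⟨u, hu⟩, funext hv⟩

theorem IsRegularLineOp.surjective (hR : IsRegularLineOp R) (hI : IsConnected (I : Set ℝ)) :
    Function.Surjective R := by
  obtain ⟨n, hn⟩ := isRegularLineOp_iff.1 hR
  exact hn.surjective hI

theorem IsRegularLineOp.finite_ker (hR : IsRegularLineOp R) (hI : IsConnected (I : Set ℝ)) :
    FiniteDimensional ℝ (LinearMap.ker R) := by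
  obtain ⟨n, hn⟩ := isRegularLineOp_iff.1 hR
  obtain ⟨e⟩ := hn.nonempty_equiv hI
  exact e.symm.finiteDimensional

theorem IsRegularLineOp.finrank_ker (hR : IsRegularLineOp R) (hI : IsConnected (I : Set ℝ)) :
    Module.finrank ℝ (LinearMap.ker R) = opOrder R := by
  obtain ⟨n, hn⟩ := isRegularLineOp_iff.1 hR
  obtain ⟨e⟩ := hn.nonempty_equiv hI
  obtain ⟨x₀, hx₀⟩ := hI.nonempty
  rw [hn.opOrder_eq hx₀, e.finrank_eq, Module.finrank_fin_fun]

theorem isRegularOfOrder_derivOp (I : Opens ℝ) : IsRegularOfOrder (derivOp I) 1 := by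
  refine ⟨SmoothFun.one I, fun x hx => by simp [SmoothFun.one_apply hx], ?_⟩
  rw [mulOp_one, pow_one, LinearMap.id_comp, sub_self]
  exact zero_mem _

/-- The derivation D is surjective but kills the constant 1, which no endomorphism of a
finite-dimensional space can do. -/
theorem not_finiteDimensional_smoothFun (hI : IsConnected (I : Set ℝ)) :
    ¬ FiniteDimensional ℝ (SmoothFun I) := by
  intro _
  obtain ⟨x₀, hx₀⟩ := hI.nonempty
  have h := LinearMap.injective_iff_surjective.2 ((isRegularOfOrder_derivOp I).surjective hI)
  have h0 : monomialFun I x₀ 0 = 0 := h (by rw [derivOp_monomialFun_zero, map_zero])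
  have h1 := monomialFun_apply x₀ 0 hx₀
  rw [h0] at h1
  simp at h1

end RegularOperators

/-! ### Kernels of echelon systems and the reduction of the multiintegral to one -/

section EchelonSystems

variable {V V' : Type*} [AddCommGroup V] [Module ℝ V] [AddCommGroup V'] [Module ℝ V'] {k p : ℕ}

/-- The linear map of column vectors given by a matrix of linear maps. -/
def matrixMap (T : Fin p → Fin k → V →ₗ[ℝ] V) : (Fin k → V) →ₗ[ℝ] (Fin p → V) :=
  LinearMap.pi fun i => ∑ j, T i j ∘ₗ LinearMap.proj j

theorem matrixMap_apply (T : Fin p → Fin k → V →ₗ[ℝ] V) (φ : Fin k → V) (i : Fin p) :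
    matrixMap T φ i = ∑ j, T i j (φ j) := by
  simp [matrixMap, LinearMap.sum_apply]

/-- A homogeneous echelon system with surjective pivots can be solved with arbitrary values of the
unknowns without pivots. -/
theorem exists_mem_ker_matrixMap (T : Fin p → Fin k → V →ₗ[ℝ] V) (q : Fin p → Fin k)
    (hq : StrictMono q) (h0 : ∀ i j, j < q i → T i j = 0)
    (hT : ∀ i, Function.Surjective (T i (q i))) (φ₀ : Fin k → V) :
    ∃ φ ∈ LinearMap.ker (matrixMap T), ∀ j, j ∉ Set.range q → φ j = φ₀ j := by
  induction p with
  | zero => exact ⟨φ₀, funext fun i => i.elim0, fun _ _ => rfl⟩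
  | succ p ih =>
    obtain ⟨φ, hφ, hφ'⟩ := ih (fun i => T i.succ) (fun i => q i.succ)
      (hq.comp (Fin.strictMono_succ)) (fun i => h0 i.succ) fun i => hT i.succ
    -- The later rows have been solved already. They do not involve the unknown `q 0`, so that
    -- unknown can be changed to satisfy the first row.
    obtain ⟨v, hv⟩ := hT 0 (-∑ j ∈ Finset.univ.erase (q 0), T 0 j (φ j))
    refine ⟨Function.update φ (q 0) v, funext fun i => ?_, fun j hj => ?_⟩
    · rw [matrixMap_apply]
      induction i using Fin.cases with
      | zero =>
        have hne : ∀ j ∈ Finset.univ.erase (q 0),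
            T 0 j (Function.update φ (q 0) v j) = T 0 j (φ j) := fun j hj => by
          rw [Function.update_of_ne (Finset.ne_of_mem_erase hj)]
        rw [← Finset.add_sum_erase _ _ (Finset.mem_univ (q 0)), Function.update_self, hv,
          Finset.sum_congr rfl hne, neg_add_cancel]
        rfl
      | succ i =>
        have := congrFun hφ i
        rw [matrixMap_apply] at this
        refine (Finset.sum_congr rfl fun j _ => ?_).trans this
        by_cases hj : j = q 0
        · rw [hj, h0 i.succ (q 0) (hq (Fin.succ_pos i))]
          simp
        · rw [Function.update_of_ne hj]
    · rw [Function.update_of_ne fun h => hj ⟨0, h.symm⟩]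
      exact hφ' j fun ⟨i, hi⟩ => hj ⟨i.succ, hi⟩

/-- With fewer rows than columns some column has no pivot, and projecting solutions to that unknown
maps the kernel onto all of `V`. -/
theorem infinite_ker_matrixMap (hV : ¬ FiniteDimensional ℝ V) (hpk : p < k)
    (T : Fin p → Fin k → V →ₗ[ℝ] V) (q : Fin p → Fin k)
    (hq : StrictMono q) (h0 : ∀ i j, j < q i → T i j = 0)
    (hT : ∀ i, Function.Surjective (T i (q i))) :
    ¬ FiniteDimensional ℝ (LinearMap.ker (matrixMap T)) := by
  intro _
  obtain ⟨j, hj⟩ : ∃ j, j ∉ Set.range q := by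
    by_contra! h
    have := Fintype.card_le_of_surjective q h
    simp only [Fintype.card_fin] at this
    omega
  refine hV (Module.Finite.of_surjective
    (LinearMap.proj j ∘ₗ (LinearMap.ker (matrixMap T)).subtype) fun v => ?_)
  obtain ⟨φ, hφ, h⟩ := exists_mem_ker_matrixMap T q hq h0 hT fun _ => v
  exact ⟨⟨φ, hφ⟩, h j hj⟩

/-- Deleting the first unknown gives an exact sequence 0 → ker T₀₀ → ker T → ker T' → 0, where T'
omits the first row and column; exactness on the right is the surjectivity of T₀₀. -/
theorem finrank_ker_matrixMap (T : Fin k → Fin k → V →ₗ[ℝ] V)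
    (h0 : ∀ i j, j < i → T i j = 0) (hT : ∀ i, Function.Surjective (T i i))
    (hfin : ∀ i, FiniteDimensional ℝ (LinearMap.ker (T i i))) :
    FiniteDimensional ℝ (LinearMap.ker (matrixMap T)) ∧
      Module.finrank ℝ (LinearMap.ker (matrixMap T)) =
        ∑ i, Module.finrank ℝ (LinearMap.ker (T i i)) := by
  induction k with
  | zero => exact ⟨inferInstance, by simp [Module.finrank_zero_of_subsingleton]⟩
  | succ k ih =>
    obtain ⟨_, hrank⟩ := ih (fun i j => T i.succ j.succ)
      (fun i j h => h0 _ _ (Fin.succ_lt_succ_iff.2 h)) (fun i => hT i.succ) fun i => hfin i.succ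
    set T' : Fin k → Fin k → V →ₗ[ℝ] V := fun i j => T i.succ j.succ
    have hmem : ∀ φ : Fin (k + 1) → V, φ ∈ LinearMap.ker (matrixMap T) ↔
        T 0 0 (φ 0) + ∑ j : Fin k, T 0 j.succ (φ j.succ) = 0 ∧
          (fun j : Fin k => φ j.succ) ∈ LinearMap.ker (matrixMap T') := by
      intro φ
      rw [LinearMap.mem_ker, LinearMap.mem_ker, funext_iff, funext_iff, Fin.forall_fin_succ]
      simp only [matrixMap_apply, Fin.sum_univ_succ, h0 _ _ (Fin.succ_pos _),
        LinearMap.zero_apply, zero_add, Pi.zero_apply, T']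
    let f : LinearMap.ker (matrixMap T) →ₗ[ℝ] LinearMap.ker (matrixMap T') :=
      LinearMap.restrict (LinearMap.funLeft ℝ V Fin.succ) fun φ hφ => ((hmem φ).1 hφ).2
    have hf : Function.Surjective f := by
      rintro ⟨ψ, hψ⟩
      obtain ⟨v, hv⟩ := hT 0 (-∑ j : Fin k, T 0 j.succ (ψ j))
      refine ⟨⟨Fin.cons v ψ, (hmem _).2 ⟨?_, hψ⟩⟩, rfl⟩
      simp [hv]
    let e : LinearMap.ker f ≃ₗ[ℝ] LinearMap.ker (T 0 0) := by
      have hker : ∀ φ : LinearMap.ker f, ∀ j : Fin k, φ.1.1 j.succ = 0 := fun φ j =>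
        congrFun (congrArg Subtype.val φ.2) j
      refine LinearEquiv.ofBijective (LinearMap.codRestrict _
        (LinearMap.proj 0 ∘ₗ Submodule.subtype _ ∘ₗ Submodule.subtype _) fun φ => ?_) ⟨?_, ?_⟩
      · have := ((hmem _).1 φ.1.2).1
        simpa [hker φ] using this
      · intro φ ψ h
        refine Subtype.ext (Subtype.ext (funext fun j => ?_))
        induction j using Fin.cases with
        | zero => exact congrArg Subtype.val h
        | succ j => rw [hker φ, hker ψ]
      · rintro ⟨v, hv⟩
        have hv' : T 0 0 v = 0 := hv
        exact ⟨⟨⟨Fin.cons v 0, (hmem _).2 ⟨by simp [hv'], zero_mem _⟩⟩, rfl⟩, rfl⟩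
    have hfin0 := hfin 0
    have : FiniteDimensional ℝ (LinearMap.ker f) := e.symm.finiteDimensional
    have : FiniteDimensional ℝ (_ ⧸ LinearMap.ker f) :=
      (f.quotKerEquivOfSurjective hf).symm.finiteDimensional
    have hX : FiniteDimensional ℝ (LinearMap.ker (matrixMap T)) :=
      Module.Finite.of_submodule_quotient (LinearMap.ker f)
    refine ⟨hX, ?_⟩
    rw [← LinearMap.finrank_range_add_finrank_ker f, LinearMap.range_eq_top.2 hf, finrank_top,
      e.finrank_eq, hrank, Fin.sum_univ_succ, add_comm]

variable (L : Fin k → V →ₗ[ℝ] V') (q : Fin p → Fin k) (K : Fin p → V →ₗ[ℝ] V')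
  (C : Fin p → V' →ₗ[ℝ] V) (T : Fin p → Fin k → V →ₗ[ℝ] V)

/-- The matrix (C_i K_l) has ones on its diagonal and zeros above it, so the row `K` is injective on
columns. As 𝒥 is the composite of this row with the matrix `T`, both have the same kernel. -/
theorem ker_eq_ker_matrixMap (hq : StrictMono q) (h0 : ∀ i j, j < q i → T i j = 0)
    (hC : ∀ i j, q i ≤ j → T i j = C i ∘ₗ (L j - ∑ l ∈ Finset.Iio i, K l ∘ₗ T l j))
    (hK : ∀ i, L (q i) - ∑ l ∈ Finset.Iio i, K l ∘ₗ T l (q i) = K i ∘ₗ T i (q i))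
    (hL : ∀ j, j ∉ Set.range q → L j - ∑ l, K l ∘ₗ T l j = 0)
    (hT : ∀ i, Function.Surjective (T i (q i))) :
    LinearMap.ker (∑ j, L j ∘ₗ LinearMap.proj j) = LinearMap.ker (matrixMap T) := by
  have hsplit : ∀ i j, ∑ l, K l ∘ₗ T l j = ∑ l ∈ Finset.Iio i, K l ∘ₗ T l j +
      ∑ l ∈ Finset.Ici i, K l ∘ₗ T l j := by
    intro i j
    rw [← Finset.sum_filter_add_sum_filter_not Finset.univ (· < i)]
    congr 2 <;> ext l <;> simp
  have hfac : ∀ j, L j = ∑ l, K l ∘ₗ T l j := by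
    intro j
    by_cases hj : j ∈ Set.range q
    · obtain ⟨i, rfl⟩ := hj
      rw [hsplit i, ← sub_eq_iff_eq_add', hK,
        Finset.sum_eq_single_of_mem i (Finset.mem_Ici.2 le_rfl)]
      intro l hl hli
      rw [h0 l _ (hq (lt_of_le_of_ne (Finset.mem_Ici.1 hl) hli.symm)), LinearMap.comp_zero]
    · exact sub_eq_zero.1 (hL j hj)
  have hC' : ∀ i j, q i ≤ j → T i j = ∑ l ∈ Finset.Ici i, (C i ∘ₗ K l) ∘ₗ T l j := by
    intro i j hij
    conv_lhs => rw [hC i j hij, hfac j, hsplit i, add_sub_cancel_left, linearMap_comp_sum]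
    rfl
  -- In the pivot column of row `i` only the term l = i survives; the surjective pivot is then
  -- cancelled.
  have hid : ∀ i, C i ∘ₗ K i = LinearMap.id := by
    intro i
    have h := hC' i (q i) le_rfl
    rw [Finset.sum_eq_single_of_mem i (Finset.mem_Ici.2 le_rfl) fun l hl hli => by
      rw [h0 l _ (hq (lt_of_le_of_ne (Finset.mem_Ici.1 hl) hli.symm)), LinearMap.comp_zero]] at h
    exact ((LinearMap.cancel_right (hT i)).1 ((LinearMap.id_comp _).trans h)).symm
  -- In the pivot column of row `l`, rows strictly between `i` and `l` drop out by induction and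
  -- rows beyond `l` by the echelon form. What is left reads T = T + C_i K_l T_l, with T_l the
  -- surjective pivot of row `l`.
  have hzero : ∀ i l, i < l → C i ∘ₗ K l = 0 := by
    intro i l
    induction l using WellFoundedLT.induction with
    | ind l ih =>
      intro hil
      have h := hC' i (q l) (hq hil).le
      rw [Finset.sum_eq_add_of_mem i l (Finset.mem_Ici.2 le_rfl) (Finset.mem_Ici.2 hil.le) hil.ne,
        hid, LinearMap.id_comp, left_eq_add] at h
      · exact (LinearMap.cancel_right (hT l)).1 (h.trans (LinearMap.zero_comp _).symm)
      · rintro m hm ⟨hmi, hml⟩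
        rcases lt_or_gt_of_ne hml with hlt | hgt
        · rw [ih m hlt (lt_of_le_of_ne (Finset.mem_Ici.1 hm) hmi.symm), LinearMap.zero_comp]
        · rw [h0 m _ (hq hgt), LinearMap.comp_zero]
  have hfactor : ∀ φ : Fin k → V,
      (∑ j, L j ∘ₗ LinearMap.proj j) φ = ∑ l, K l (matrixMap T φ l) := by
    intro φ
    simp only [LinearMap.sum_apply, LinearMap.comp_apply, LinearMap.proj_apply, matrixMap_apply,
      map_sum]
    rw [Finset.sum_comm]
    refine Finset.sum_congr rfl fun j _ => ?_
    rw [hfac j, LinearMap.sum_apply]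
    rfl
  -- Forward substitution: after applying C_i, earlier terms vanish because ψ_l = 0 is known, later
  -- ones because C_i K_l = 0.
  have hinj : ∀ ψ : Fin p → V, ∑ l, K l (ψ l) = 0 → ∀ i, ψ i = 0 := by
    intro ψ hψ i
    induction i using WellFoundedLT.induction with
    | ind i ih =>
      have h := congrArg (C i) hψ
      rw [map_sum, map_zero, Finset.sum_eq_single_of_mem i (Finset.mem_univ i)] at h
      · exact (LinearMap.congr_fun (hid i) (ψ i)).symm.trans h
      · intro l _ hli
        rcases lt_or_gt_of_ne hli with hlt | hgt
        · rw [ih l hlt, map_zero, map_zero]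
        · exact LinearMap.congr_fun (hzero i l hgt) (ψ l)
  ext φ
  rw [LinearMap.mem_ker, LinearMap.mem_ker, hfactor]
  refine ⟨fun h => funext (hinj _ h), fun h => ?_⟩
  simp [h]

end EchelonSystems

/-! ### The kernel of the multiintegral from a run of RMI -/

section RunKernel

variable {I J : Opens ℝ}

/-- The linear map `f ↦ P₁ f(·, y₁) + ⋯ + Pₛ f(·, yₛ)`. -/
noncomputable def combOp (w : List (J × LineMap I)) : SmoothFun (openRect I J) →ₗ[ℝ] SmoothFun I :=
  (w.map fun u => u.2 ∘ₗ evalOp u.1).sum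

/-- This exhibits the combination as left composition with one map independent of `N`: the C_i
required by `ker_eq_ker_matrixMap`. -/
theorem pointComb_eq (w : List (J × LineMap I)) (N : PlaneMap I J) :
    pointComb w N = combOp w ∘ₗ N := by
  induction w with
  | nil => rfl
  | cons u w ih =>
    rw [pointComb, combOp, List.map_cons, List.sum_cons, List.map_cons, List.sum_cons,
      LinearMap.add_comp, ← combOp, ← ih]
    rfl

theorem IsRMIOutput.multiKer_spec {k p : ℕ} {L : Fin k → PlaneMap I J} {M : Fin p → PlaneMap I J}
    {R : Matrix (Fin p) (Fin k) (LineMap I)} (hI : IsConnected (I : Set ℝ))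
    (h : IsRMIOutput L M R) :
    p ≤ k ∧ (¬ FiniteDimensional ℝ (multiKer L) ↔ p < k) ∧
      ∀ hp : p = k, Module.finrank ℝ (multiKer L) =
        ∑ i : Fin p, opOrder (R i (Fin.cast hp i)) := by
  obtain ⟨q, K, w, T, S, h⟩ := h
  have hsurj : ∀ i, Function.Surjective (T i (q i)) := fun i => (h.pivot i).regular.surjective hI
  have hker : multiKer L = LinearMap.ker (matrixMap T) := by
    refine ker_eq_ker_matrixMap L q K (fun i => combOp (w i)) T h.strictMono h.left_zero
      (fun i j hij => ?_) (fun i => (h.pivot i).factor) h.no_pivot hsurj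
    rcases hij.eq_or_lt with rfl | hlt
    · rw [← pointComb_eq]
      exact (h.pivot i).gcd
    · rw [← pointComb_eq]
      exact h.eliminate i j hlt
  have hpk : p ≤ k := by
    simpa using Fintype.card_le_of_injective q h.strictMono.injective
  have hsq : ∀ hp : p = k, FiniteDimensional ℝ (multiKer L) ∧ Module.finrank ℝ (multiKer L) =
      ∑ i : Fin p, opOrder (R i (Fin.cast hp i)) := by
    rintro rfl
    -- A strictly increasing map of a finite chain to itself is the identity, so in the square case
    -- the pivots lie on the diagonal.
    have hq : q = id := by
      have := Subsingleton.elim (h.strictMono.orderIsoOfSurjective q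
        (Finite.injective_iff_surjective.1 h.strictMono.injective)) (OrderIso.refl _)
      exact funext fun i => DFunLike.congr_fun this i
    subst hq
    obtain ⟨h1, h2⟩ := finrank_ker_matrixMap T h.left_zero hsurj fun i =>
      (h.pivot i).regular.finite_ker hI
    rw [hker]
    refine ⟨h1, h2.trans (Finset.sum_congr rfl fun i _ => ?_)⟩
    -- Stage B subtracts multiples of rows l > i, whose entries in column `i` lie left of their
    -- pivots and vanish.
    have hR : R i i = T i i := by
      rw [h.stageB, Finset.sum_eq_zero, sub_zero]
      intro l hl
      rw [h.left_zero l i (Finset.mem_Ioi.1 hl), LinearMap.comp_zero]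
    exact ((h.pivot i).regular.finrank_ker hI).trans (congrArg opOrder hR.symm)
  refine ⟨hpk, ⟨fun hinf => lt_of_le_of_ne hpk fun hp => hinf (hsq hp).1, fun hlt => ?_⟩,
    fun hp => (hsq hp).2⟩
  rw [hker]
  exact infinite_ker_matrixMap (not_finiteDimensional_smoothFun hI) hlt T q h.strictMono
    h.left_zero hsurj

end RunKernel

/-! ### Closure of differential operators under sums, composition and evaluation -/

section OperatorClosure

variable {I J : Opens ℝ}

theorem IsLineOp.id : IsLineOp (LinearMap.id : LineMap I) :=
  isLineOp_iff.2 ⟨1, by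
    have h := monomial_mem_ordLT_id (SmoothFun.one I) Nat.zero_lt_one
    rwa [mulOp_one] at h⟩

theorem IsLineOp.zero : IsLineOp (0 : LineMap I) := isLineOp_iff.2 ⟨0, zero_mem _⟩

theorem IsLineOp.add {A B : LineMap I} (hA : IsLineOp A) (hB : IsLineOp B) : IsLineOp (A + B) := by
  obtain ⟨n, hA⟩ := isLineOp_iff.1 hA
  obtain ⟨m, hB⟩ := isLineOp_iff.1 hB
  exact isLineOp_iff.2 ⟨max n m, add_mem (ordLT_mono (le_max_left _ _) hA)
    (ordLT_mono (le_max_right _ _) hB)⟩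

theorem IsLineOp.neg {A : LineMap I} (hA : IsLineOp A) : IsLineOp (-A) := by
  obtain ⟨n, hA⟩ := isLineOp_iff.1 hA
  exact isLineOp_iff.2 ⟨n, neg_mem hA⟩

theorem IsLineOp.comp {A B : LineMap I} (hA : IsLineOp A) (hB : IsLineOp B) :
    IsLineOp (A ∘ₗ B) := by
  obtain ⟨n, hA⟩ := isLineOp_iff.1 hA
  obtain ⟨m, hB⟩ := isLineOp_iff.1 hB
  exact isLineOp_iff.2 ⟨m + n, isPullback_id.comp_mem_ordLT_add hA hB⟩

theorem IsPlaneOp.add {A B : PlaneMap I J} (hA : IsPlaneOp A) (hB : IsPlaneOp B) :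
    IsPlaneOp (A + B) := by
  obtain ⟨n, hA⟩ := isPlaneOp_iff.1 hA
  obtain ⟨m, hB⟩ := isPlaneOp_iff.1 hB
  exact isPlaneOp_iff.2 ⟨max n m, add_mem (ordLT_mono (le_max_left _ _) hA)
    (ordLT_mono (le_max_right _ _) hB)⟩

theorem IsPlaneOp.neg {A : PlaneMap I J} (hA : IsPlaneOp A) : IsPlaneOp (-A) := by
  obtain ⟨n, hA⟩ := isPlaneOp_iff.1 hA
  exact isPlaneOp_iff.2 ⟨n, neg_mem hA⟩

theorem IsPlaneOp.sub {A B : PlaneMap I J} (hA : IsPlaneOp A) (hB : IsPlaneOp B) :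
    IsPlaneOp (A - B) := by
  rw [sub_eq_add_neg]
  exact hA.add hB.neg

theorem IsPlaneOp.comp {A : PlaneMap I J} {B : LineMap I} (hA : IsPlaneOp A) (hB : IsLineOp B) :
    IsPlaneOp (A ∘ₗ B) := by
  obtain ⟨n, hA⟩ := isPlaneOp_iff.1 hA
  obtain ⟨m, hB⟩ := isLineOp_iff.1 hB
  exact isPlaneOp_iff.2 ⟨m + n, (isPullback_pullOp I J).comp_mem_ordLT_add hA hB⟩

theorem IsPlaneOp.evalOp_comp {A : PlaneMap I J} (hA : IsPlaneOp A) (y : J) :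
    IsLineOp (evalOp y ∘ₗ A) := by
  obtain ⟨n, hA⟩ := isPlaneOp_iff.1 hA
  exact isLineOp_iff.2 ⟨n, evalOp_comp_mem_ordLT y hA⟩

theorem combOp_cons (u : J × LineMap I) (w : List (J × LineMap I)) :
    combOp (u :: w) = u.2 ∘ₗ evalOp u.1 + combOp w := by
  rw [combOp, List.map_cons, List.sum_cons]
  rfl

theorem IsPlaneOp.combOp_comp {N : PlaneMap I J} (hN : IsPlaneOp N) {w : List (J × LineMap I)}
    (hw : ∀ u ∈ w, IsLineOp u.2) : IsLineOp (combOp w ∘ₗ N) := by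
  induction w with
  | nil => exact IsLineOp.zero
  | cons u w ih =>
    rw [combOp_cons, LinearMap.add_comp, LinearMap.comp_assoc]
    rw [List.forall_mem_cons] at hw
    exact (hw.1.comp (hN.evalOp_comp u.1)).add (ih hw.2)

theorem IsRegularLineOp.isLineOp {R : LineMap I} (hR : IsRegularLineOp R) : IsLineOp R := by
  obtain ⟨n, c, h, -⟩ := hR
  exact ⟨n, c, h⟩

theorem exists_evalOp_comp_ne_zero {N : PlaneMap I J} (hN : N ≠ 0) :
    ∃ y : J, evalOp y ∘ₗ N ≠ 0 := by
  by_contra! h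
  refine hN (LinearMap.ext fun f => SmoothFun.ext_on fun z hz => ?_)
  exact congrArg (fun g : SmoothFun I => g.1 z.1) (LinearMap.congr_fun (h ⟨z.2, hz.2⟩) f)

end OperatorClosure

/-! ### Restriction of operators to a smaller interval -/

section Restriction

variable {I I' J : Opens ℝ}

theorem openRect_mono (h : I' ≤ I) : openRect I' J ≤ openRect I J := fun _ hz => ⟨h hz.1, hz.2⟩

theorem resOp_comp_resOp {E : Type*} [NormedAddCommGroup E] [NormedSpace ℝ E] {U V W : Opens E}
    (h₁ : V ≤ U) (h₂ : W ≤ V) : resOp h₂ ∘ₗ resOp h₁ = resOp (h₂.trans h₁) :=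
  LinearMap.ext fun f => SmoothFun.ext_on fun z hz => by
    rw [LinearMap.comp_apply, resOp_apply h₂ _ hz, resOp_apply h₁ _ (h₂ hz), resOp_apply _ _ hz]

/-- This carries operator identities over to a smaller interval: it suffices to verify them on
functions that come from the larger one. -/
theorem IsLineOp.eq_of_comp_resOp (h : I' ≤ I) {A B : LineMap I'} (hA : IsLineOp A)
    (hB : IsLineOp B) (hAB : A ∘ₗ resOp h = B ∘ₗ resOp h) : A = B := by
  obtain ⟨n, hn⟩ := isLineOp_iff.1 (hA.add hB.neg)
  have := isPullback_id.eq_zero_of_comp_resOp h hn (by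
    rw [LinearMap.add_comp, hAB, LinearMap.neg_comp, add_neg_cancel])
  exact eq_of_sub_eq_zero (by rw [sub_eq_add_neg, this])

theorem IsPlaneOp.eq_of_comp_resOp (h : I' ≤ I) {A B : PlaneMap I' J} (hA : IsPlaneOp A)
    (hB : IsPlaneOp B) (hAB : A ∘ₗ resOp h = B ∘ₗ resOp h) : A = B := by
  obtain ⟨n, hn⟩ := isPlaneOp_iff.1 (hA.sub hB)
  exact eq_of_sub_eq_zero ((isPullback_pullOp I' J).eq_zero_of_comp_resOp h hn (by
    rw [LinearMap.sub_comp, hAB, sub_self]))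

theorem exists_restrict_ordLT (h : I' ≤ I) {n : ℕ} {A : LineMap I}
    (hA : A ∈ ordLT (LinearMap.id : LineMap I) n) :
    ∃ A' ∈ ordLT (LinearMap.id : LineMap I') n, A' ∘ₗ resOp h = resOp h ∘ₗ A :=
  exists_restrict h h rfl hA

theorem IsLineOp.exists_restrict (h : I' ≤ I) {A : LineMap I} (hA : IsLineOp A) :
    ∃ A' : LineMap I', IsLineOp A' ∧ A' ∘ₗ resOp h = resOp h ∘ₗ A := by
  obtain ⟨n, hA⟩ := isLineOp_iff.1 hA
  obtain ⟨A', hA', h'⟩ := exists_restrict_ordLT h hA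
  exact ⟨A', isLineOp_iff.2 ⟨n, hA'⟩, h'⟩

theorem IsPlaneOp.exists_restrict (h : I' ≤ I) {A : PlaneMap I J} (hA : IsPlaneOp A) :
    ∃ A' : PlaneMap I' J, IsPlaneOp A' ∧ A' ∘ₗ resOp h = resOp (openRect_mono h) ∘ₗ A := by
  obtain ⟨n, hA⟩ := isPlaneOp_iff.1 hA
  obtain ⟨A', hA', h'⟩ := _root_.exists_restrict h (openRect_mono h)
    (resOp_comp_pullOp h (openRect_mono h)) hA
  exact ⟨A', isPlaneOp_iff.2 ⟨n, hA'⟩, h'⟩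

/-- Only the interval of `x` shrinks, so the points of `J` are kept and just the operators are
restricted. -/
theorem exists_restrict_list (h : I' ≤ I) {w : List (J × LineMap I)}
    (hw : ∀ u ∈ w, IsLineOp u.2) :
    ∃ w' : List (J × LineMap I'), (∀ u ∈ w', IsLineOp u.2) ∧
      combOp w' ∘ₗ resOp (openRect_mono h) = resOp h ∘ₗ combOp w := by
  induction w with
  | nil => exact ⟨[], by simp, by simp [combOp]⟩
  | cons u w ih =>
    rw [List.forall_mem_cons] at hw
    obtain ⟨w', hw', h'⟩ := ih hw.2
    obtain ⟨P, hP, hP'⟩ := hw.1.exists_restrict h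
    refine ⟨(u.1, P) :: w', List.forall_mem_cons.2 ⟨hP, hw'⟩, ?_⟩
    rw [combOp_cons, combOp_cons, LinearMap.add_comp, LinearMap.comp_add, h', LinearMap.comp_assoc,
      ← resOp_comp_evalOp h, ← LinearMap.comp_assoc, hP', LinearMap.comp_assoc]

theorem IsRegularLineOp.exists_restrict (h : I' ≤ I) {R : LineMap I} (hR : IsRegularLineOp R) :
    ∃ R' : LineMap I', IsRegularLineOp R' ∧ R' ∘ₗ resOp h = resOp h ∘ₗ R := by
  obtain ⟨m, c, hc, hR⟩ := isRegularLineOp_iff.1 hR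
  obtain ⟨B, hB, hB'⟩ := exists_restrict_ordLT h hR
  refine ⟨B + mulOp (resOp h c) ∘ₗ (derivOp I' ^ m), isRegularLineOp_iff.2 ⟨m, resOp h c,
    fun x hx => ?_, by rwa [add_sub_cancel_right]⟩, ?_⟩
  · rw [resOp_apply h c hx]
    exact hc x (h hx)
  · rw [LinearMap.add_comp, hB', LinearMap.comp_assoc, ← resOp_comp_derivOp_pow,
      ← LinearMap.comp_assoc _ _ (mulOp _), ← resOp_comp_mulOp, LinearMap.comp_assoc,
      ← LinearMap.comp_add, sub_add_cancel]

/-- A non-zero operator has a leading coefficient without zeros on some smaller interval. -/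
theorem exists_restrict_isRegularOfOrder {n : ℕ} {R : LineMap I}
    (hR : R ∈ ordLT (LinearMap.id : LineMap I) n) (h0 : R ≠ 0) :
    ∃ (I' : Opens ℝ) (h : I' ≤ I), IsConnected (I' : Set ℝ) ∧ ∃ m < n, ∃ R' : LineMap I',
      IsRegularOfOrder R' m ∧ R' ∘ₗ resOp h = resOp h ∘ₗ R := by
  induction n with
  | zero => exact absurd (ordLT_zero_eq hR) h0
  | succ n ih =>
    obtain ⟨a, ha⟩ := hR
    rw [Finset.sum_range_succ] at ha
    have hB : R - mulOp (a n) ∘ₗ (derivOp I ^ n) ∈ ordLT (LinearMap.id : LineMap I) n :=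
      ⟨a, by rw [ha]; exact add_sub_cancel_right _ _⟩
    -- An identically zero top coefficient is dropped by induction; otherwise it is non-zero on a
    -- ball around some point, by continuity.
    by_cases han : a n = 0
    · rw [han, mulOp_zero, LinearMap.zero_comp, sub_zero] at hB
      obtain ⟨I', h, hI', m, hm, H⟩ := ih hB
      exact ⟨I', h, hI', m, hm.trans (Nat.lt_succ_self n), H⟩
    · obtain ⟨x, hx, hax⟩ : ∃ x ∈ I, (a n).1 x ≠ 0 := by
        by_contra! hcon
        exact han (SmoothFun.ext_on hcon)
      have hcont : ContinuousAt (a n).1 x := ((a n).differentiableAt hx).continuousAt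
      obtain ⟨ε, hε, hball⟩ := Metric.eventually_nhds_iff_ball.1
        ((hcont.eventually_ne hax).and (I.isOpen.mem_nhds hx))
      let I' : Opens ℝ := ⟨Metric.ball x ε, Metric.isOpen_ball⟩
      have h : I' ≤ I := fun y hy => (hball y hy).2
      obtain ⟨B, hB1, hB2⟩ := exists_restrict_ordLT h hB
      refine ⟨I', h, ⟨⟨x, Metric.mem_ball_self hε⟩, (convex_ball x ε).isPreconnected⟩, n,
        Nat.lt_succ_self n, B + mulOp (resOp h (a n)) ∘ₗ (derivOp I' ^ n),
        ⟨resOp h (a n), fun y hy => ?_, by rwa [add_sub_cancel_right]⟩, ?_⟩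
      · rw [resOp_apply h _ hy]
        exact (hball y hy).1
      · rw [LinearMap.add_comp, hB2, LinearMap.comp_assoc, ← resOp_comp_derivOp_pow,
          ← LinearMap.comp_assoc _ _ (mulOp _), ← resOp_comp_mulOp, LinearMap.comp_assoc,
          ← LinearMap.comp_add, sub_add_cancel]

end Restriction

/-! ### Right division with remainder -/

section RightDivision

variable {I J : Opens ℝ}

/-- Right division with remainder by an operator whose leading coefficient has no zeros. -/
theorem IsRegularOfOrder.exists_right_div {R : LineMap I} {m : ℕ} (hR : IsRegularOfOrder R m)
    {n : ℕ} {N : PlaneMap I J} (hN : N ∈ ordLT (pullOp I J) n) :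
    ∃ K : PlaneMap I J, IsPlaneOp K ∧ N - K ∘ₗ R ∈ ordLT (pullOp I J) m := by
  induction n generalizing N with
  | zero =>
    rw [ordLT_zero_eq hN]
    exact ⟨0, isPlaneOp_iff.2 ⟨0, zero_mem _⟩, by simp⟩
  | succ n ih =>
    rcases Nat.lt_or_ge n m with hnm | hmn
    · exact ⟨0, isPlaneOp_iff.2 ⟨0, zero_mem _⟩, by
        rw [LinearMap.zero_comp, sub_zero]; exact ordLT_mono hnm hN⟩
    · obtain ⟨c, hc, hRc⟩ := hR
      obtain ⟨a, rfl⟩ := hN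
      have hc' : ∀ z ∈ openRect I J, (pullOp I J c).1 z ≠ 0 := fun z hz => by
        rw [(isPullback_pullOp I J).apply c z hz]
        exact hc _ hz.1
      -- With b = a_n / c, the operator b D^(n-m) R has the leading term a_n D^n, so subtracting it
      -- lowers the order.
      set b := mulOp ((pullOp I J c).inv hc') (a n) with hb
      have hbc : mulOp b ∘ₗ mulOp (pullOp I J c) = mulOp (a n) := by
        rw [mulOp_comp_mulOp]
        congr 1
        refine SmoothFun.ext_on fun z hz => ?_
        change ((pullOp I J c).1 z)⁻¹ * (a n).1 z * (pullOp I J c).1 z = (a n).1 z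
        field_simp [hc' z hz]
      set K₁ : PlaneMap I J := mulOp b ∘ₗ pullOp I J ∘ₗ (derivOp I ^ (n - m)) with hK₁
      have hK : IsPlaneOp K₁ :=
        isPlaneOp_iff.2 ⟨n - m + 1, monomial_mem_ordLT b (Nat.lt_succ_self _)⟩
      have hlead := derivOp_pow_comp_sub_mem_ordLT hRc (n - m)
      rw [Nat.add_sub_cancel' hmn] at hlead
      have hmem := mulOp_comp_mem_ordLT b ((isPullback_pullOp I J).comp_mem_ordLT hlead)
      have htop : mulOp b ∘ₗ pullOp I J ∘ₗ mulOp c ∘ₗ (derivOp I ^ n) =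
          mulOp (a n) ∘ₗ pullOp I J ∘ₗ (derivOp I ^ n) := by
        rw [← LinearMap.comp_assoc _ (mulOp c) (pullOp I J), (isPullback_pullOp I J).comp_mulOp,
          LinearMap.comp_assoc, ← LinearMap.comp_assoc _ _ (mulOp b), hbc]
      have hsub : ∑ j ∈ Finset.range (n + 1), mulOp (a j) ∘ₗ pullOp I J ∘ₗ (derivOp I ^ j) -
          K₁ ∘ₗ R = ∑ j ∈ Finset.range n, mulOp (a j) ∘ₗ pullOp I J ∘ₗ (derivOp I ^ j) -
          mulOp b ∘ₗ pullOp I J ∘ₗ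
            ((derivOp I ^ (n - m)) ∘ₗ R - mulOp c ∘ₗ (derivOp I ^ n)) := by
        rw [Finset.sum_range_succ, LinearMap.comp_sub, LinearMap.comp_sub, htop]
        change _ - mulOp b ∘ₗ pullOp I J ∘ₗ ((derivOp I ^ (n - m)) ∘ₗ R) = _
        abel
      obtain ⟨K₂, hK₂, hrem⟩ := ih (N := ∑ j ∈ Finset.range (n + 1),
        mulOp (a j) ∘ₗ pullOp I J ∘ₗ (derivOp I ^ j) - K₁ ∘ₗ R) (by
          rw [hsub]
          exact sub_mem ⟨a, rfl⟩ hmem)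
      refine ⟨K₁ + K₂, hK.add hK₂, ?_⟩
      rwa [LinearMap.add_comp, ← sub_sub]

end RightDivision

/-! ### Existence of an output of RI -/

section AlgorithmRI

variable {I J : Opens ℝ}

/-- `m` is the order of a regular left combination of values of `N` on some subinterval. -/
def IsCombOrder (N : PlaneMap I J) (m : ℕ) : Prop :=
  ∃ (I' : Opens ℝ) (h : I' ≤ I), IsConnected (I' : Set ℝ) ∧ ∃ N' : PlaneMap I' J, IsPlaneOp N' ∧
    N' ∘ₗ resOp h = resOp (openRect_mono h) ∘ₗ N ∧ ∃ w : List (J × LineMap I'),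
      (∀ u ∈ w, IsLineOp u.2) ∧ IsRegularOfOrder (combOp w ∘ₗ N') m

/-- A non-zero combination becomes regular after shrinking, with order below the given bound; this
supplies both the first candidate in RI and the descent. -/
theorem exists_isCombOrder_lt {N : PlaneMap I J} (hN : IsPlaneOp N) {w : List (J × LineMap I)}
    (hw : ∀ u ∈ w, IsLineOp u.2) {n : ℕ}
    (hn : combOp w ∘ₗ N ∈ ordLT (LinearMap.id : LineMap I) n) (h0 : combOp w ∘ₗ N ≠ 0) :
    ∃ m < n, IsCombOrder N m := by
  obtain ⟨I', h, hI', m, hm, R', hR', hres⟩ := exists_restrict_isRegularOfOrder hn h0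
  obtain ⟨N', hN', hNres⟩ := hN.exists_restrict h
  obtain ⟨w', hw', hwres⟩ := exists_restrict_list h hw
  refine ⟨m, hm, I', h, hI', N', hN', hNres, w', hw', ?_⟩
  have : combOp w' ∘ₗ N' = R' := by
    refine IsLineOp.eq_of_comp_resOp h (hN'.combOp_comp hw')
      (isLineOp_iff.2 ⟨_, hR'.mem_ordLT⟩) ?_
    rw [hres, LinearMap.comp_assoc, hNres, ← LinearMap.comp_assoc, hwres, LinearMap.comp_assoc]
  rwa [this]

theorem IsCombOrder.of_restrict {I' : Opens ℝ} (h : I' ≤ I) {N : PlaneMap I J}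
    {N' : PlaneMap I' J} (hres : N' ∘ₗ resOp h = resOp (openRect_mono h) ∘ₗ N) {m : ℕ}
    (hm : IsCombOrder N' m) : IsCombOrder N m := by
  obtain ⟨I'', h', hI'', N'', hN'', hres', w⟩ := hm
  refine ⟨I'', h'.trans h, hI'', N'', hN'', ?_, w⟩
  rw [← resOp_comp_resOp h h', ← LinearMap.comp_assoc, hres', LinearMap.comp_assoc, hres,
    ← LinearMap.comp_assoc, resOp_comp_resOp]

theorem combOp_map_comp (Q : LineMap I) (w : List (J × LineMap I)) :
    combOp (w.map fun u => (u.1, Q ∘ₗ u.2)) = Q ∘ₗ combOp w := by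
  induction w with
  | nil => simp [combOp]
  | cons u w ih =>
    rw [List.map_cons, combOp_cons, combOp_cons, ih, LinearMap.comp_add, LinearMap.comp_assoc]

/-- The algorithm **RI** has an output after shrinking the interval of the variable `x`. -/
theorem exists_isRIOutput {N : PlaneMap I J} (hN : IsPlaneOp N) (h0 : N ≠ 0) :
    ∃ (I' : Opens ℝ) (h : I' ≤ I), IsConnected (I' : Set ℝ) ∧ ∃ N' : PlaneMap I' J,
      IsPlaneOp N' ∧ N' ∘ₗ resOp h = resOp (openRect_mono h) ∘ₗ N ∧
        ∃ K R w, IsRIOutput N' K R w := by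
  classical
  have hex : ∃ m, IsCombOrder N m := by
    obtain ⟨y, hy⟩ := exists_evalOp_comp_ne_zero h0
    have hy' : combOp [(y, LinearMap.id)] = evalOp y (I := I) := by
      simp [combOp]
    obtain ⟨n, hn⟩ := isPlaneOp_iff.1 hN
    obtain ⟨m, -, hm⟩ := exists_isCombOrder_lt hN (w := [(y, LinearMap.id)])
      (by simpa using IsLineOp.id) (by rw [hy']; exact evalOp_comp_mem_ordLT y hn)
      (by rwa [hy'])
    exact ⟨m, hm⟩
  -- The least possible order, over all subintervals and all combinations, takes the place of the
  -- Euclidean algorithm.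
  obtain ⟨I', h, hI', N', hN', hres, w, hw, hreg⟩ := Nat.find_spec hex
  obtain ⟨n, hn⟩ := isPlaneOp_iff.1 hN'
  obtain ⟨K, hK, hrem⟩ := hreg.exists_right_div hn
  refine ⟨I', h, hI', N', hN', hres, K, combOp w ∘ₗ N', w, hK, hw,
    isRegularLineOp_iff.2 ⟨_, hreg⟩, (pointComb_eq w N').symm, ?_⟩
  by_contra hne
  obtain ⟨y, hy⟩ := exists_evalOp_comp_ne_zero (sub_ne_zero.2 hne)
  -- This list represents N(x, y) - K(x, y) R(x), the remainder at `y`, as a combination of values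
  -- of N: the value at `y` itself, and the old combination multiplied by -K(x, y).
  set w' : List (J × LineMap I') := (y, LinearMap.id) ::
    w.map fun u => (u.1, (-(evalOp y ∘ₗ K)) ∘ₗ u.2) with hw'
  have hcomb : combOp w' ∘ₗ N' = evalOp y ∘ₗ (N' - K ∘ₗ combOp w ∘ₗ N') := by
    rw [hw', combOp_cons, combOp_map_comp, LinearMap.id_comp, LinearMap.add_comp,
      LinearMap.neg_comp, LinearMap.neg_comp, LinearMap.comp_sub, sub_eq_add_neg]
    rfl
  obtain ⟨m, hm, hm'⟩ := exists_isCombOrder_lt hN' (w := w') (by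
      rw [hw', List.forall_mem_cons]
      refine ⟨IsLineOp.id, fun u hu => ?_⟩
      obtain ⟨v, hv, rfl⟩ := List.mem_map.1 hu
      exact (hK.evalOp_comp y).neg.comp (hw v hv))
    (by rw [hcomb]; exact evalOp_comp_mem_ordLT y hrem) (by rwa [hcomb])
  exact Nat.find_min hex hm (hm'.of_restrict h hres)

/-- An output found for one column must survive the shrinkings required by later columns. Its two
identities are between differential operators, so they can be checked after composition with
`resOp`. -/
theorem IsRIOutput.exists_restrict {I' : Opens ℝ} (h : I' ≤ I) {N K : PlaneMap I J} {R : LineMap I}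
    {w : List (J × LineMap I)} (H : IsRIOutput N K R w) {N' : PlaneMap I' J}
    (hN' : IsPlaneOp N') (hres : N' ∘ₗ resOp h = resOp (openRect_mono h) ∘ₗ N) :
    ∃ K' R' w', IsRIOutput N' K' R' w' ∧ K' ∘ₗ resOp h = resOp (openRect_mono h) ∘ₗ K ∧
      combOp w' ∘ₗ resOp (openRect_mono h) = resOp h ∘ₗ combOp w := by
  obtain ⟨K', hK', hKres⟩ := H.isPlaneOp.exists_restrict h
  obtain ⟨R', hR', hRres⟩ := H.regular.exists_restrict h
  obtain ⟨w', hw', hwres⟩ := exists_restrict_list h H.isLineOp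
  refine ⟨K', R', w', ⟨hK', hw', hR', ?_, ?_⟩, hKres, hwres⟩
  · rw [pointComb_eq]
    refine hR'.isLineOp.eq_of_comp_resOp h (hN'.combOp_comp hw') ?_
    rw [hRres, H.gcd, pointComb_eq, LinearMap.comp_assoc, hres, ← LinearMap.comp_assoc, hwres.symm,
      LinearMap.comp_assoc]
  · refine hN'.eq_of_comp_resOp h (hK'.comp hR'.isLineOp) ?_
    rw [hres, LinearMap.comp_assoc, hRres, ← LinearMap.comp_assoc, hKres, LinearMap.comp_assoc,
      ← H.factor]

end AlgorithmRI

/-! ### Existence of an output of RMI -/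

section AlgorithmRMI

variable {I J : Opens ℝ} {k p : ℕ}

/-- The elimination stage of a run of the algorithm **RMI**. -/
structure IsElimination (L : Fin k → PlaneMap I J) (q : Fin p → Fin k)
    (K : Fin p → PlaneMap I J) (w : Fin p → List (J × LineMap I))
    (T : Fin p → Fin k → LineMap I) : Prop where
  strictMono : StrictMono q
  left_zero : ∀ i j, j < q i → T i j = 0
  eliminate : ∀ i j, q i < j →
    T i j = pointComb (w i) (L j - ∑ l ∈ Finset.Iio i, K l ∘ₗ T l j)
  pivot : ∀ i,
    IsRIOutput (L (q i) - ∑ l ∈ Finset.Iio i, K l ∘ₗ T l (q i)) (K i) (T i (q i)) (w i)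
  no_pivot : ∀ j, j ∉ Set.range q → L j - ∑ l, K l ∘ₗ T l j = 0

/-- The choice S = 0 makes stages B and C trivial: M = K and R = T. -/
theorem IsElimination.isRMIOutput {L : Fin k → PlaneMap I J} {q : Fin p → Fin k}
    {K : Fin p → PlaneMap I J} {w : Fin p → List (J × LineMap I)}
    {T : Fin p → Fin k → LineMap I} (h : IsElimination L q K w T) : IsRMIOutput L K T :=
  ⟨q, K, w, T, fun _ _ => 0, h.strictMono, h.left_zero, h.eliminate, h.pivot, h.no_pivot,
    fun _ _ => IsLineOp.zero, fun i j => by simp, fun i => by simp⟩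

theorem sum_Iio_succ {M : Type*} [AddCommMonoid M] (i : Fin p) (f : Fin (p + 1) → M) :
    ∑ l ∈ Finset.Iio i.succ, f l = f 0 + ∑ l ∈ Finset.Iio i, f l.succ := by
  have h : ∀ (n : ℕ) (i : Fin n) (g : Fin n → M),
      ∑ l ∈ Finset.Iio i, g l = ∑ l, if l < i then g l else 0 := fun n i g => by
    rw [← Finset.sum_filter]
    congr 1
    ext l
    simp
  rw [h, h, Fin.sum_univ_succ]
  simp [Fin.succ_lt_succ_iff]

theorem Iio_zero_eq_empty : Finset.Iio (0 : Fin (p + 1)) = ∅ :=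
  Finset.eq_empty_of_forall_notMem fun l hl => Fin.not_lt_zero l (Finset.mem_Iio.1 hl)

/-- A zero column creates no row. -/
theorem IsElimination.cons_zero {L : Fin (k + 1) → PlaneMap I J} (h0 : L 0 = 0)
    {q : Fin p → Fin k} {K : Fin p → PlaneMap I J} {w : Fin p → List (J × LineMap I)}
    {T : Fin p → Fin k → LineMap I} (h : IsElimination (fun j => L j.succ) q K w T) :
    IsElimination L (fun i => (q i).succ) K w (fun i => Fin.cons 0 (T i)) where
  strictMono := Fin.strictMono_succ.comp h.strictMono
  left_zero i j hj := by
    induction j using Fin.cases with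
    | zero => rfl
    | succ j => exact h.left_zero i j (Fin.succ_lt_succ_iff.1 hj)
  eliminate i j hj := by
    induction j using Fin.cases with
    | zero => exact absurd hj (Fin.not_lt_zero _)
    | succ j => exact h.eliminate i j (Fin.succ_lt_succ_iff.1 hj)
  pivot := h.pivot
  no_pivot j hj := by
    induction j using Fin.cases with
    | zero => simp [h0]
    | succ j => exact h.no_pivot j fun ⟨i, hi⟩ => hj ⟨i, congrArg Fin.succ hi⟩

/-- A non-zero first column creates the first row. -/
theorem IsElimination.cons_pivot {L : Fin (k + 1) → PlaneMap I J} {K₀ : PlaneMap I J}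
    {R₀ : LineMap I} {w₀ : List (J × LineMap I)} (h0 : IsRIOutput (L 0) K₀ R₀ w₀)
    {q : Fin p → Fin k} {K : Fin p → PlaneMap I J} {w : Fin p → List (J × LineMap I)}
    {T : Fin p → Fin k → LineMap I}
    (h : IsElimination (fun j => L j.succ - K₀ ∘ₗ pointComb w₀ (L j.succ)) q K w T) :
    IsElimination L (Fin.cons 0 fun i => (q i).succ : Fin (p + 1) → Fin (k + 1))
      (Fin.cons K₀ K : Fin (p + 1) → PlaneMap I J)
      (Fin.cons w₀ w : Fin (p + 1) → List (J × LineMap I))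
      (Fin.cons (Fin.cons R₀ fun j => pointComb w₀ (L j.succ)) fun i => Fin.cons 0 (T i) :
        Fin (p + 1) → Fin (k + 1) → LineMap I) where
  strictMono := by
    intro i i' hii
    induction i' using Fin.cases with
    | zero => exact absurd hii (Fin.not_lt_zero _)
    | succ i' =>
      induction i using Fin.cases with
      | zero => exact Fin.succ_pos _
      | succ i => exact Fin.succ_lt_succ_iff.2 (h.strictMono (Fin.succ_lt_succ_iff.1 hii))
  left_zero i j hj := by
    induction i using Fin.cases with
    | zero => exact absurd hj (Fin.not_lt_zero _)
    | succ i =>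
      induction j using Fin.cases with
      | zero => rfl
      | succ j => exact h.left_zero i j (Fin.succ_lt_succ_iff.1 hj)
  eliminate i j hj := by
    induction j using Fin.cases with
    | zero => exact absurd hj (Fin.not_lt_zero _)
    | succ j =>
      induction i using Fin.cases with
      | zero =>
        rw [Iio_zero_eq_empty, Finset.sum_empty, sub_zero]
        rfl
      | succ i =>
        rw [sum_Iio_succ, ← sub_sub]
        exact h.eliminate i j (Fin.succ_lt_succ_iff.1 hj)
  pivot i := by
    induction i using Fin.cases with
    | zero =>
      rw [Iio_zero_eq_empty, Finset.sum_empty, sub_zero]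
      exact h0
    | succ i =>
      rw [sum_Iio_succ, ← sub_sub]
      exact h.pivot i
  no_pivot j hj := by
    induction j using Fin.cases with
    | zero => exact absurd ⟨0, rfl⟩ hj
    | succ j =>
      rw [Fin.sum_univ_succ, ← sub_sub]
      exact h.no_pivot j fun ⟨i, hi⟩ => hj ⟨i.succ, congrArg Fin.succ hi⟩

/-- The algorithm **RMI** has an output after shrinking the interval of the variable `x`. -/
theorem exists_isElimination (hI : IsConnected (I : Set ℝ)) (L : Fin k → PlaneMap I J)
    (hL : ∀ j, IsPlaneOp (L j)) :
    ∃ (I' : Opens ℝ) (h : I' ≤ I), IsConnected (I' : Set ℝ) ∧ ∃ L' : Fin k → PlaneMap I' J,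
      (∀ j, IsPlaneOp (L' j)) ∧ (∀ j, L' j ∘ₗ resOp h = resOp (openRect_mono h) ∘ₗ L j) ∧
        ∃ (p : ℕ) (q : Fin p → Fin k) (K : Fin p → PlaneMap I' J)
          (w : Fin p → List (J × LineMap I')) (T : Fin p → Fin k → LineMap I'),
          IsElimination L' q K w T := by
  induction k generalizing I with
  | zero =>
    exact ⟨I, le_rfl, hI, fun j => j.elim0, fun j => j.elim0, fun j => j.elim0, 0,
      fun i => i.elim0, fun i => i.elim0, fun i => i.elim0, fun i => i.elim0,
      fun i => i.elim0, fun i => i.elim0, fun i => i.elim0, fun i => i.elim0, fun j => j.elim0⟩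
  | succ k ih =>
    by_cases h0 : L 0 = 0
    · obtain ⟨I', h, hI', L', hL', hres, p, q, K, w, T, H⟩ :=
        ih hI (fun j => L j.succ) fun j => hL j.succ
      exact ⟨I', h, hI', (Fin.cons 0 L' : Fin (k + 1) → PlaneMap I' J),
        Fin.cases (isPlaneOp_iff.2 ⟨0, zero_mem _⟩) hL',
        Fin.cases (by rw [h0]; simp) hres,
        p, _, K, w, _, H.cons_zero (L := (Fin.cons 0 L' : Fin (k + 1) → PlaneMap I' J)) rfl⟩
    -- RI gives the first row; the induction then applies to the remaining columns reduced by that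
    -- row, and may shrink the interval once more.
    · obtain ⟨I₁, h₁, hI₁, N₀, hN₀, hNres, K₀, R₀, w₀, hRI⟩ := exists_isRIOutput (hL 0) h0
      choose L₁ hL₁ hres₁ using fun j : Fin k => (hL j.succ).exists_restrict h₁
      obtain ⟨I₂, h₂, hI₂, N₂, hN₂, hres₂, p, q, K, w, T, H⟩ :=
        ih hI₁ (fun j => L₁ j - K₀ ∘ₗ pointComb w₀ (L₁ j)) fun j => (hL₁ j).sub
          (hRI.isPlaneOp.comp (by rw [pointComb_eq]; exact (hL₁ j).combOp_comp hRI.isLineOp))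
      obtain ⟨N₀', hN₀', hNres'⟩ := hN₀.exists_restrict h₂
      choose L₂ hL₂ hLres₂ using fun j : Fin k => (hL₁ j).exists_restrict h₂
      obtain ⟨K₀', R₀', w₀', hRI', hK', hw'⟩ := hRI.exists_restrict h₂ hN₀' hNres'
      -- Reduction by the first row commutes with restriction, so the columns returned by the
      -- induction are the reductions of the restricted columns by the restricted first row.
      have hN₂eq : N₂ = fun j => L₂ j - K₀' ∘ₗ pointComb w₀' (L₂ j) := by
        funext j
        refine (hN₂ j).eq_of_comp_resOp h₂ ((hL₂ j).sub (hRI'.isPlaneOp.comp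
          (by rw [pointComb_eq]; exact (hL₂ j).combOp_comp hRI'.isLineOp))) ?_
        rw [hres₂, pointComb_eq, pointComb_eq, LinearMap.sub_comp, LinearMap.comp_sub, hLres₂,
          LinearMap.comp_assoc, LinearMap.comp_assoc, hLres₂, ← LinearMap.comp_assoc _ _ (combOp w₀'),
          hw', LinearMap.comp_assoc, ← LinearMap.comp_assoc _ _ K₀', hK', LinearMap.comp_assoc]
      rw [hN₂eq] at H
      have hcomp : ∀ {A : PlaneMap I J} {B : PlaneMap I₁ J} {C : PlaneMap I₂ J},
          B ∘ₗ resOp h₁ = resOp (openRect_mono h₁) ∘ₗ A →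
          C ∘ₗ resOp h₂ = resOp (openRect_mono h₂) ∘ₗ B →
          C ∘ₗ resOp (h₂.trans h₁) = resOp (openRect_mono (h₂.trans h₁)) ∘ₗ A := by
        intro A B C hB hC
        rw [← resOp_comp_resOp h₁ h₂, ← LinearMap.comp_assoc, hC, LinearMap.comp_assoc, hB,
          ← LinearMap.comp_assoc, resOp_comp_resOp]
      exact ⟨I₂, h₂.trans h₁, hI₂, (Fin.cons N₀' L₂ : Fin (k + 1) → PlaneMap I₂ J),
        Fin.cases hN₀' hL₂, Fin.cases (hcomp hNres hNres') fun j => hcomp (hres₁ j) (hLres₂ j),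
        p + 1, _, _, _, _,
        IsElimination.cons_pivot (L := (Fin.cons N₀' L₂ : Fin (k + 1) → PlaneMap I₂ J)) hRI' H⟩

theorem isPlaneOp_operatorRow {U : Opens (ℝ × ℝ)} {n : Fin k → ℕ}
    (a : (i : Fin k) → Fin (n i + 1) → SmoothFun U) (h : openRect I J ≤ U) (i : Fin k) :
    IsPlaneOp (operatorRow a I J h i) := ⟨_, _, rfl⟩

theorem operatorRow_comp_resOp {U : Opens (ℝ × ℝ)} {n : Fin k → ℕ}
    (a : (i : Fin k) → Fin (n i + 1) → SmoothFun U) (h : openRect I J ≤ U) {I' : Opens ℝ}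
    (hI' : I' ≤ I) (i : Fin k) :
    operatorRow a I' J ((openRect_mono hI').trans h) i ∘ₗ resOp hI' =
      resOp (openRect_mono hI') ∘ₗ operatorRow a I J h i := by
  rw [operatorRow, operatorRow, planeOp, planeOp, linearMap_comp_sum, linearMap_sum_comp]
  refine Finset.sum_congr rfl fun j _ => ?_
  have hres : SmoothFun.restrict ((openRect_mono hI').trans h) (a i j) =
      resOp (openRect_mono hI') (SmoothFun.restrict h (a i j)) :=
    (LinearMap.congr_fun (resOp_comp_resOp h (openRect_mono hI')) (a i j)).symm
  rw [hres, ← LinearMap.comp_assoc _ _ (resOp _), resOp_comp_mulOp, LinearMap.comp_assoc,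
    LinearMap.comp_assoc, LinearMap.comp_assoc, ← LinearMap.comp_assoc _ _ (resOp _),
    resOp_comp_pullOp hI', LinearMap.comp_assoc, resOp_comp_derivOp_pow]

theorem exists_openRect_le {U : Opens (ℝ × ℝ)} (hU : (U : Set (ℝ × ℝ)).Nonempty) :
    ∃ I J : Opens ℝ, openRect I J ≤ U ∧ IsConnected (I : Set ℝ) ∧ IsConnected (J : Set ℝ) := by
  obtain ⟨z, hz⟩ := hU
  obtain ⟨ε, hε, h⟩ := Metric.isOpen_iff.1 U.isOpen z hz
  refine ⟨⟨Metric.ball z.1 ε, Metric.isOpen_ball⟩, ⟨Metric.ball z.2 ε, Metric.isOpen_ball⟩,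
    fun x hx => h ?_, ⟨⟨z.1, Metric.mem_ball_self hε⟩, (convex_ball _ _).isPreconnected⟩,
    ⟨⟨z.2, Metric.mem_ball_self hε⟩, (convex_ball _ _).isPreconnected⟩⟩
  rw [← ball_prod_same]
  exact hx

end AlgorithmRMI

theorem mainTheorem6 {k : ℕ} (U : Opens (ℝ × ℝ)) (hU : (U : Set (ℝ × ℝ)).Nonempty)
    (n : Fin k → ℕ) (a : (i : Fin k) → Fin (n i + 1) → SmoothFun U) :
    (∃ (I J : Opens ℝ) (h : openRect I J ≤ U),
      IsConnected (I : Set ℝ) ∧ IsConnected (J : Set ℝ) ∧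
      ∃ (p : ℕ) (M : Fin p → PlaneMap I J) (R : Matrix (Fin p) (Fin k) (LineMap I)),
        IsRMIOutput (operatorRow a I J h) M R) ∧
    ∀ (I J : Opens ℝ) (h : openRect I J ≤ U),
      IsConnected (I : Set ℝ) → IsConnected (J : Set ℝ) →
      ∀ (p : ℕ) (M : Fin p → PlaneMap I J) (R : Matrix (Fin p) (Fin k) (LineMap I)),
        IsRMIOutput (operatorRow a I J h) M R →
        p ≤ k ∧
        (¬ FiniteDimensional ℝ (multiKer (operatorRow a I J h)) ↔ p < k) ∧
        ∀ hp : p = k,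
          Module.finrank ℝ (multiKer (operatorRow a I J h)) =
            ∑ i : Fin p, opOrder (R i (Fin.cast hp i)) := by
  refine ⟨?_, fun I J h hI _ p M R hR => hR.multiKer_spec hI⟩
  obtain ⟨I, J, h, hI, hJ⟩ := exists_openRect_le hU
  obtain ⟨I', h', hI', L', hL', hres, p, q, K, w, T, H⟩ :=
    exists_isElimination hI (operatorRow a I J h) (isPlaneOp_operatorRow a h)
  -- The run found concerns some restriction of the row; as such restrictions are unique, it is the
  -- row with restricted coefficients.
  have hrow : L' = operatorRow a I' J ((openRect_mono h').trans h) := funext fun j =>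
    (hL' j).eq_of_comp_resOp h' (isPlaneOp_operatorRow a _ j)
      ((hres j).trans (operatorRow_comp_resOp a h h' j).symm)
  subst hrow
  exact ⟨I', J, (openRect_mono h').trans h, hI', hJ, p, K, T, H.isRMIOutput⟩
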